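/- Consider an M/M/1 queue with two classes of customers. Customers of class $A$ and of class $B$ arrive according to independent Poisson processes with rates $\lambda_A>0$ and $\lambda_B\ge 0$, service times are i.i.d. exponential with rate $\mu>0$, and $A$-customers have preemptive priority over $B$-customers. Put $\rho_A=\lambda_A/\mu$. Each class has a planner. At every event (an arrival or a point of the rate-$\mu$ process of service completions), knowing the numbers of customers of both classes and the whole history, and possibly randomizing, the planner decides which customers of the own class are admitted or made to renege. The $A$-planner receives a reward $R_A$ for each completed service of an $A$-customer and pays a cost $C_A>0$ for each unit of time that an $A$-customer spends in the system, where $R_A\mu\ge C_A$. Let $W_T(\sigma,\tau,s)$ be the net benefit of the $A$-planner up to time $T$ when the $A$-planner uses the strategy $\sigma$, the $B$-planner uses $\tau$, and the initial state is $s=(n_A,n_B)$. A strategy $\sigma$ of the $A$-planner is called optimal if it maximizes the long-run expected net benefit per unit of time against every $\tau$ and from every $s$, that is, if for all $\tau$, $s$ and all strategies $\sigma'$ of the $A$-planner $$\limsup_{T\to\infty}\frac{\mathbb E[W_T(\sigma',\tau,s)]}{T}\;\le\;\liminf_{T\to\infty}\frac{\mathbb E[W_T(\sigma,\tau,s)]}{T}.$$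 The threshold strategy with threshold $m\in\{0,1,2,\dots\}$ admits an arriving $A$-customer if and only if this customer finds fewer than $m$ $A$-customers in the system, and never makes an $A$-customer renege. Theorem. The net benefit $W_T(\sigma,\tau,s)$ is integrable for all $\sigma,\tau,s$ and all $T\ge 0$. The equation $$\frac{R_A\mu}{C_A}=\begin{cases}\dfrac{x(1-\rho_A)-\rho_A(1-\rho_A^{x})}{(1-\rho_A)^2}&\text{if }\rho_A\ne 1,\\[2mm] \dfrac{x(x+1)}{2}&\text{if }\rho_A=1,\end{cases}$$ has a unique solution $x=n_A^*$ in $[0,\infty)$, and the threshold strategy with threshold $\lfloor n_A^*\rfloor$ is an optimal strategy of the $A$-planner. Moreover, no other threshold strategy is optimal, except possibly the one with threshold $n_A^*-1$ when $n_A^*$ is an integer. -/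

import Mathlib

open MeasureTheory ProbabilityTheory Filter

namespace PriorityQueue

/-- The events of the two-class queue. `service` is a point of the Poisson process of rate `μ` of
service completions; it has no effect when the system is empty. -/
inductive Event : Type
  | arrivalA : Event
  | arrivalB : Event
  | service : Event

instance : MeasurableSpace Event := ⊤

/-- One step of the driving process: the event that occurs, the time elapsed since the previous
event, and an independent random number that strategies may use to randomize. -/
abbrev Epoch : Type := Event × ℝ × unitInterval

/-- A realisation of the sequence of events. -/
abbrev Path : Type := ℕ → Epoch

/-- The next event is an `A`-arrival, a `B`-arrival or a service completion, with probabilities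
proportional to the rates `lamA`, `lamB`, `mu`. -/
noncomputable def eventLaw (lamA lamB mu : ℝ) : Measure Event :=
  ENNReal.ofReal (lamA / (lamA + lamB + mu)) • Measure.dirac Event.arrivalA
    + ENNReal.ofReal (lamB / (lamA + lamB + mu)) • Measure.dirac Event.arrivalB
    + ENNReal.ofReal (mu / (lamA + lamB + mu)) • Measure.dirac Event.service

/-- The law of one step: event, elapsed time and random number are independent, the elapsed time
is exponential with the total rate, the random number is uniform on `[0,1]`. -/
noncomputable def epochLaw (lamA lamB mu : ℝ) : Measure Epoch :=
  (eventLaw lamA lamB mu).prod ((expMeasure (lamA + lamB + mu)).prod volume)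

/-- The law of the whole sequence of events: the steps are independent and identically
distributed. So `A`-arrivals, `B`-arrivals and service completions occur at the points of three
independent Poisson processes of rates `lamA`, `lamB`, `mu`. -/
noncomputable def pathLaw (lamA lamB mu : ℝ) : Measure Path :=
  Measure.infinitePi (fun _ : ℕ => epochLaw lamA lamB mu)

/-- A (history-dependent, possibly randomized) strategy of the planner of one class. Just after
the `k`-th event, given the history up to and including this event and the numbers of `A`- and
`B`-customers then present (a newcomer included), it prescribes the largest number of customers of
the planner's own class that may be in the system from then on. So it decides whether a newcomer
is admitted and how many customers, if any, are made to renege. -/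
structure Strategy : Type where
  keep : (k : ℕ) → (Fin (k + 1) → Epoch) → ℕ × ℕ → ℕ
  measurable_keep : ∀ (k : ℕ) (s : ℕ × ℕ), Measurable (fun h => keep k h s)

/-- The numbers of `A`- and `B`-customers after an event and before the planners intervene. The
`A`-customers have preemptive priority: a service completion is that of an `A`-customer whenever
one is present. -/
def afterEvent : Event → ℕ × ℕ → ℕ × ℕ
  | Event.arrivalA, s => (s.1 + 1, s.2)
  | Event.arrivalB, s => (s.1, s.2 + 1)
  | Event.service, s => if 0 < s.1 then (s.1 - 1, s.2) else (s.1, s.2 - 1)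

/-- The numbers `(n_A, n_B)` of customers in the system after `k` events, when it starts from `s₀`
and the planners use `σ` (class `A`) and `τ` (class `B`). -/
def state (σ τ : Strategy) (s₀ : ℕ × ℕ) (ω : Path) : ℕ → ℕ × ℕ
  | 0 => s₀
  | k + 1 =>
    let s := afterEvent (ω k).1 (state σ τ s₀ ω k)
    (min s.1 (σ.keep k (fun i => ω i) s), min s.2 (τ.keep k (fun i => ω i) s))

/-- The time of the `k`-th event (with value `0` for `k = 0`). -/
noncomputable def eventTime (ω : Path) (k : ℕ) : ℝ :=
  ∑ i ∈ Finset.range k, (ω i).2.1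

/-- The number of events up to time `t`; it is almost surely finite. -/
noncomputable def eventCount (ω : Path) (t : ℝ) : ℕ :=
  Set.ncard {k : ℕ | eventTime ω (k + 1) ≤ t}

/-- The number of `A`-customers in the system at time `t`. -/
noncomputable def customersA (σ τ : Strategy) (s₀ : ℕ × ℕ) (ω : Path) (t : ℝ) : ℕ :=
  (state σ τ s₀ ω (eventCount ω t)).1

open Classical in
/-- The number of services of `A`-customers completed up to time `t`. -/
noncomputable def servedA (σ τ : Strategy) (s₀ : ℕ × ℕ) (ω : Path) (t : ℝ) : ℕ :=
  ((Finset.range (eventCount ω t)).filter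
    (fun k => (ω k).1 = Event.service ∧ 0 < (state σ τ s₀ ω k).1)).card

/-- The net benefit of the `A`-planner up to time `T`: the reward `RA` for each completed service
of an `A`-customer, minus `CA` for each unit of time that an `A`-customer spends in the system. -/
noncomputable def netBenefitA (RA CA : ℝ) (σ τ : Strategy) (s₀ : ℕ × ℕ) (T : ℝ) (ω : Path) : ℝ :=
  RA * (servedA σ τ s₀ ω T : ℝ) - CA * ∫ t in (0 : ℝ)..T, (customersA σ τ s₀ ω t : ℝ)

/-- The expected net benefit of the `A`-planner per unit of time, up to time `T`. -/
noncomputable def averageBenefitA (lamA lamB mu RA CA : ℝ) (σ τ : Strategy) (s₀ : ℕ × ℕ)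
    (T : ℝ) : ℝ :=
  (∫ ω, netBenefitA RA CA σ τ s₀ T ω ∂(pathLaw lamA lamB mu)) / T

/-- `σ` is an optimal strategy of the `A`-planner: it maximizes the long-run expected net benefit
per unit of time, whatever the strategy `τ` of the `B`-planner and the initial state. The worst
limit value for `σ` is compared with the best limit value for `σ'`. -/
def IsOptimalA (lamA lamB mu RA CA : ℝ) (σ : Strategy) : Prop :=
  ∀ (τ : Strategy) (s₀ : ℕ × ℕ) (σ' : Strategy),
    limsup (fun T : ℝ => ((averageBenefitA lamA lamB mu RA CA σ' τ s₀ T : ℝ) : EReal)) atTop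
      ≤ liminf (fun T : ℝ => ((averageBenefitA lamA lamB mu RA CA σ τ s₀ T : ℝ) : EReal)) atTop

/-- The number of `A`-customers that the threshold rule retains after the given event, when `i` of
them are present, a newcomer included: an arriving `A`-customer is admitted if and only if fewer
than `m` `A`-customers are found in the system, and nobody is made to renege. -/
def thresholdKeep (m : ℕ) : Event → ℕ → ℕ
  | Event.arrivalA, i => if i - 1 < m then i else i - 1
  | Event.arrivalB, i => i
  | Event.service, i => i

/-- The threshold strategy of the `A`-planner with threshold `m`. -/
def thresholdStrategyA (m : ℕ) : Strategy where
  keep k h s := thresholdKeep m (h (Fin.last k)).1 s.1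
  measurable_keep k s := by
    have h1 : Measurable (fun e : Event => thresholdKeep m e s.1) := measurable_from_top
    exact h1.comp ((measurable_pi_apply (Fin.last k)).fst)

/-- The right-hand side of the equation for the threshold, as a function of a real number `x`. -/
noncomputable def naorFunction (rho x : ℝ) : ℝ :=
  if rho = 1 then x * (x + 1) / 2
  else (x * (1 - rho) - rho * (1 - rho ^ x)) / (1 - rho) ^ 2

end PriorityQueue

namespace PriorityQueue

/-! ### The exponential law -/

/-! Under preemptive priority the `A`-customers never notice class `B`, so the problem is the
control of one birth-death queue under the average-reward criterion. It is solved by a verification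
argument. Given a number `g` and a function `h` of the number of `A`-customers such that reward rate
plus expected drift of `h` is at most `g` in every state, the expected net benefit up to `T` is at
most `g * T + 2 * sup |h|`, whatever the history dependence or randomization
(`integral_netBenefitA_le`); equality in every visited state gives the matching lower bound
(`abs_integral_netBenefitA_sub_le`). The probabilistic input is the compensation formula
`integral_occurs_mul`, which turns sums over events into integrals over time, together with
geometric tails for the number of events.

For the threshold `m` the right `g` is `gain`, the mean of `v - C * k` over the busy states of the
truncated geometric law, with `v = RA * mu`. The increments of `h` are the `marginalValue`s,
obtained by solving the balance recursion upwards from the empty state; the one at `m` vanishes for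
`g = gain m`. For the bound against all strategies, `h` is made flat above `m = ⌊x⌋`. It is
increasing because no smaller threshold has a larger gain, so turning customers away or making them
renege cannot raise it, and above `m` the waiting cost enforces the inequality.

The comparison of gains rests on `gain_succ_sub`: passing from `m` to `m + 1` changes the gain with
the sign of `v / C - naorFunction (m + 1)`. As `naorFunction` is strictly increasing, the gain rises
until the root `x` is passed and then falls, with a tie only if `x` is an integer. -/

lemma expMeasure_real_Ioi {r : ℝ} (hr : 0 < r) {x : ℝ} (hx : 0 ≤ x) :
    (expMeasure r).real (Set.Ioi x) = Real.exp (-(r * x)) := by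
  have := isProbabilityMeasure_expMeasure hr
  have h := cdf_expMeasure_eq hr x
  rw [if_pos hx, cdf_eq_real] at h
  rw [← Set.compl_Iic, probReal_compl_eq_one_sub measurableSet_Iic, h]
  ring

lemma expMeasure_ae_pos {r : ℝ} (hr : 0 < r) : ∀ᵐ x ∂(expMeasure r), 0 < x := by
  have := isProbabilityMeasure_expMeasure hr
  have h := cdf_expMeasure_eq hr 0
  rw [if_pos le_rfl, cdf_eq_real] at h
  have h2 : expMeasure r (Set.Iic 0) = 0 := by
    rw [← measureReal_eq_zero_iff, h]; simp
  rw [ae_iff]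
  convert h2 using 2
  ext x; simp

/-- The exponential law is memoryless: the expected time spent before `T`, when waiting from `S`,
is the probability that the waiting time ends before `T`, divided by the rate. -/
lemma integral_min_sub_min_expMeasure {r : ℝ} (hr : 0 < r) (S T : ℝ) :
    r * ∫ x, (min (S + x) T - min S T) ∂(expMeasure r)
      = (expMeasure r).real {x | S + x ≤ T} := by
  have := isProbabilityMeasure_expMeasure hr
  have hnn : ∀ᵐ x ∂(expMeasure r), 0 ≤ min (S + x) T - min S T := by
    filter_upwards [expMeasure_ae_pos hr] with x hx
    have : min S T ≤ min (S + x) T := min_le_min_right _ (by linarith)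
    linarith
  have hint : Integrable (fun x => min (S + x) T - min S T) (expMeasure r) := by
    refine Integrable.of_bound (C := T - min S T) (by fun_prop) ?_
    filter_upwards [hnn] with x hx
    rw [Real.norm_of_nonneg hx]
    linarith [min_le_right (S + x) T]
  have hcdf : (expMeasure r).real {x | S + x ≤ T}
      = if 0 ≤ T - S then 1 - Real.exp (-(r * (T - S))) else 0 := by
    rw [← cdf_expMeasure_eq hr, cdf_eq_real]
    congr 1
    ext x
    simp only [Set.mem_ofPred_eq, Set.mem_Iic]
    constructor <;> intro h <;> linarith
  -- Layer-cake formula: the mean of the truncated waiting time is the integral of its tail `exp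
  -- (-(r * t))` over `0 < t < T - S`.
  rw [hint.integral_eq_integral_meas_lt hnn, hcdf]
  have hset : ∀ t ∈ Set.Ioi (0 : ℝ), (expMeasure r).real {a | t < min (S + a) T - min S T}
      = (Set.Iio (T - S)).indicator (fun t => Real.exp (-(r * t))) t := by
    intro t ht
    have ht' : 0 < t := ht
    by_cases htc : t < T - S
    · rw [Set.indicator_of_mem (by exact htc), ← expMeasure_real_Ioi hr ht'.le]
      congr 1
      ext x
      simp only [Set.mem_ofPred_eq, Set.mem_Ioi]
      rw [min_eq_left (show S ≤ T by linarith), lt_sub_iff_add_lt, lt_min_iff]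
      constructor
      · rintro ⟨h1, h2⟩; linarith
      · intro h; exact ⟨by linarith, by linarith⟩
    · rw [Set.indicator_of_notMem (by exact htc)]
      have : {a | t < min (S + a) T - min S T} = ∅ := by
        ext x
        simp only [Set.mem_ofPred_eq, Set.mem_empty_iff_false, iff_false, not_lt]
        rcases le_total S T with h | h
        · rw [min_eq_left h]; linarith [min_le_right (S + x) T]
        · rw [min_eq_right h]; linarith [min_le_right (S + x) T]
      rw [this]; simp
  rw [setIntegral_congr_fun measurableSet_Ioi hset, setIntegral_indicator measurableSet_Iio]
  split_ifs with hc
  · rw [show Set.Ioi (0 : ℝ) ∩ Set.Iio (T - S) = Set.Ioo 0 (T - S) from rfl,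
      ← integral_Ioc_eq_integral_Ioo, ← intervalIntegral.integral_of_le hc]
    have : ∀ x ∈ Set.uIcc 0 (T - S),
        HasDerivAt (fun x => -(Real.exp (-(r * x)) / r)) (Real.exp (-(r * x))) x := by
      intro x _
      have h1 : HasDerivAt (fun x : ℝ => -(r * x)) (-(r * 1)) x :=
        ((hasDerivAt_id x).const_mul r).neg
      have h2 := (h1.exp.div_const r).neg
      have h3 : -(Real.exp (-(r * x)) * -(r * 1) / r) = Real.exp (-(r * x)) := by
        field_simp
      rwa [h3] at h2
    rw [intervalIntegral.integral_eq_sub_of_hasDerivAt this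
      (Continuous.intervalIntegrable (by fun_prop) _ _)]
    simp
    field_simp
    ring
  · rw [show Set.Ioi (0 : ℝ) ∩ Set.Iio (T - S) = ∅ by
      ext x; simp only [Set.mem_inter_iff, Set.mem_Ioi, Set.mem_Iio, Set.mem_empty_iff_false]
      constructor
      · rintro ⟨h1, h2⟩; linarith
      · exact False.elim]
    simp

/-- The Laplace transform `r / (r + s)` at `s = r`; this choice yields the ratio `1 / 2` in the tail
bounds. -/
lemma integral_exp_neg_mul_expMeasure {r : ℝ} (hr : 0 < r) :
    ∫ x, Real.exp (-(r * x)) ∂(expMeasure r) = 1 / 2 := by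
  have := isProbabilityMeasure_expMeasure hr
  have hrw : ∫ x, Real.exp (-(r * x)) ∂(expMeasure r)
      = ∫ x in Set.Ioi (0 : ℝ), r * Real.exp (-(2 * r) * x) := by
    change ∫ x, Real.exp (-(r * x))
      ∂(volume.withDensity fun x => ENNReal.ofReal (gammaPDFReal 1 r x)) = _
    rw [integral_withDensity_eq_integral_toReal_smul
      (measurable_gammaPDFReal 1 r).ennreal_ofReal (by simp),
      ← integral_Ici_eq_integral_Ioi, ← integral_indicator measurableSet_Ici]
    congr 1
    ext x
    by_cases hx : 0 ≤ x
    · rw [Set.indicator_of_mem (by exact hx),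
        ENNReal.toReal_ofReal (gammaPDFReal_nonneg zero_lt_one hr x)]
      simp only [gammaPDFReal, if_pos hx, smul_eq_mul]
      simp
      rw [mul_assoc, ← Real.exp_add]
      congr 2; ring
    · rw [Set.indicator_of_notMem (by exact hx),
        ENNReal.toReal_ofReal (gammaPDFReal_nonneg zero_lt_one hr x)]
      simp [gammaPDFReal, if_neg hx]
  rw [hrw, integral_const_mul, integral_exp_mul_Ioi (by linarith)]
  simp
  field_simp

/-! ### The law of the driving process -/

instance : Countable Event :=
  Function.Injective.countable (f := fun e : Event => match e with
    | Event.arrivalA => 0 | Event.arrivalB => 1 | Event.service => (2 : ℕ)) (by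
    intro a b h; cases a <;> cases b <;> simp_all)

instance : DiscreteMeasurableSpace Event := ⟨fun _ => trivial⟩

lemma isProbabilityMeasure_eventLaw {lamA lamB mu : ℝ} (hA : 0 < lamA) (hB : 0 ≤ lamB)
    (hmu : 0 < mu) : IsProbabilityMeasure (eventLaw lamA lamB mu) := by
  have hL : 0 < lamA + lamB + mu := by positivity
  constructor
  simp only [eventLaw, Measure.coe_add, Measure.coe_smul, Pi.add_apply, Pi.smul_apply,
    measure_univ, smul_eq_mul, mul_one]
  rw [← ENNReal.ofReal_add (by positivity) (by positivity),
    ← ENNReal.ofReal_add (by positivity) (by positivity)]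
  rw [← ENNReal.ofReal_one]
  congr 1
  field_simp

/-- `∑ₑ (rate of e) * f e`. -/
def rateSum (lamA lamB mu : ℝ) (f : Event → ℝ) : ℝ :=
  lamA * f Event.arrivalA + lamB * f Event.arrivalB + mu * f Event.service

lemma integral_eventLaw {lamA lamB mu : ℝ} (hA : 0 < lamA) (hB : 0 ≤ lamB)
    (hmu : 0 < mu) (f : Event → ℝ) :
    (lamA + lamB + mu) * ∫ e, f e ∂(eventLaw lamA lamB mu) = rateSum lamA lamB mu f := by
  have hL : 0 < lamA + lamB + mu := by positivity
  have hf : ∀ e, Integrable f (Measure.dirac e) := fun e => integrable_dirac (by simp)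
  have hi : ∀ (c : ℝ) e, Integrable f (ENNReal.ofReal c • Measure.dirac e) := fun c e =>
    (hf e).smul_measure (by simp)
  rw [eventLaw, integral_add_measure ((hi _ _).add_measure (hi _ _)) (hi _ _),
    integral_add_measure (hi _ _) (hi _ _)]
  simp only [integral_smul_measure, integral_dirac, rateSum, smul_eq_mul]
  rw [ENNReal.toReal_ofReal (by positivity), ENNReal.toReal_ofReal (by positivity),
    ENNReal.toReal_ofReal (by positivity)]
  field_simp

lemma isProbabilityMeasure_epochLaw {lamA lamB mu : ℝ} (hA : 0 < lamA) (hB : 0 ≤ lamB)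
    (hmu : 0 < mu) : IsProbabilityMeasure (epochLaw lamA lamB mu) := by
  have := isProbabilityMeasure_eventLaw hA hB hmu
  have := isProbabilityMeasure_expMeasure (show 0 < lamA + lamB + mu by positivity)
  unfold epochLaw; infer_instance

lemma isProbabilityMeasure_pathLaw {lamA lamB mu : ℝ} (hA : 0 < lamA) (hB : 0 ≤ lamB)
    (hmu : 0 < mu) : IsProbabilityMeasure (pathLaw lamA lamB mu) := by
  have := isProbabilityMeasure_epochLaw hA hB hmu
  unfold pathLaw; infer_instance

lemma measurable_update_epoch (k : ℕ) :
    Measurable (fun p : Path × Epoch => Function.update p.1 k p.2) := by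
  refine measurable_pi_lambda _ fun i => ?_
  by_cases h : i = k
  · subst h; simpa using measurable_snd
  · simp only [Function.update_of_ne h]
    exact (measurable_pi_apply i).comp measurable_fst

/-- Replacing the `k`-th step by an independent copy does not change the law of the sequence. -/
lemma measurePreserving_update {lamA lamB mu : ℝ} (hA : 0 < lamA) (hB : 0 ≤ lamB)
    (hmu : 0 < mu) (k : ℕ) :
    MeasurePreserving (fun p : Path × Epoch => Function.update p.1 k p.2)
      ((pathLaw lamA lamB mu).prod (epochLaw lamA lamB mu)) (pathLaw lamA lamB mu) := by
  have := isProbabilityMeasure_epochLaw hA hB hmu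
  have := isProbabilityMeasure_pathLaw hA hB hmu
  refine ⟨measurable_update_epoch k, ?_⟩
  refine Measure.eq_infinitePi _ fun s t ht => ?_
  rw [Measure.map_apply (measurable_update_epoch k)
    (MeasurableSet.pi s.countable_toSet fun i _ => ht i)]
  -- The constraint on coordinate `k`, if any, moves to the fresh copy, while the old coordinate
  -- becomes free.
  have hpre : (fun p : Path × Epoch => Function.update p.1 k p.2) ⁻¹' ((s : Set ℕ).pi t)
      = (((s.erase k : Finset ℕ) : Set ℕ).pi t) ×ˢ (if k ∈ s then t k else Set.univ) := by
    ext ⟨w, b⟩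
    simp only [Set.mem_preimage, Set.mem_pi, Set.mem_prod, Finset.mem_coe, Finset.mem_erase]
    constructor
    · intro h
      refine ⟨fun i hi => by simpa [Function.update_of_ne hi.1] using h i hi.2, ?_⟩
      split_ifs with hk
      · simpa using h k hk
      · trivial
    · rintro ⟨h1, h2⟩ i hi
      by_cases hik : i = k
      · subst hik; simpa [hi] using h2
      · simpa [Function.update_of_ne hik] using h1 i ⟨hik, hi⟩
  rw [hpre, Measure.prod_prod, pathLaw, Measure.infinitePi_pi _ fun i _ => ht i]
  split_ifs with hk
  · rw [Finset.prod_erase_mul _ _ hk]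
  · rw [Finset.erase_eq_of_notMem hk, measure_univ, mul_one]

/-- Plays the role of conditioning on all steps except the `k`-th: these are frozen and only step
`k` is averaged. -/
lemma integral_pathLaw_update {lamA lamB mu : ℝ} (hA : 0 < lamA) (hB : 0 ≤ lamB)
    (hmu : 0 < mu) (k : ℕ) {F : Path → ℝ} (hF : Integrable F (pathLaw lamA lamB mu)) :
    ∫ w, F w ∂(pathLaw lamA lamB mu)
      = ∫ w, ∫ b, F (Function.update w k b) ∂(epochLaw lamA lamB mu) ∂(pathLaw lamA lamB mu) := by
  have := isProbabilityMeasure_epochLaw hA hB hmu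
  have := isProbabilityMeasure_pathLaw hA hB hmu
  have h := measurePreserving_update hA hB hmu k
  rw [← integral_prod (fun p : Path × Epoch => F (Function.update p.1 k p.2))
    (h.integrable_comp_of_integrable hF)]
  conv_lhs => rw [← h.map_eq]
  rw [integral_map h.aemeasurable]
  rw [h.map_eq]; exact hF.aestronglyMeasurable

lemma measurePreserving_elapsed {lamA lamB mu : ℝ} (hA : 0 < lamA) (hB : 0 ≤ lamB)
    (hmu : 0 < mu) (k : ℕ) :
    MeasurePreserving (fun w : Path => (w k).2.1) (pathLaw lamA lamB mu)
      (expMeasure (lamA + lamB + mu)) := by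
  have := isProbabilityMeasure_eventLaw hA hB hmu
  have := isProbabilityMeasure_expMeasure (show 0 < lamA + lamB + mu by positivity)
  have := isProbabilityMeasure_epochLaw hA hB hmu
  have h1 : MeasurePreserving (fun w : Path => w k) (pathLaw lamA lamB mu)
      (epochLaw lamA lamB mu) :=
    measurePreserving_eval_infinitePi (fun _ : ℕ => epochLaw lamA lamB mu) k
  have h2 : MeasurePreserving (Prod.snd : Epoch → ℝ × unitInterval) (epochLaw lamA lamB mu)
    ((expMeasure (lamA + lamB + mu)).prod volume) := measurePreserving_snd
  have h3 : MeasurePreserving (Prod.fst : ℝ × unitInterval → ℝ)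
    ((expMeasure (lamA + lamB + mu)).prod volume) (expMeasure (lamA + lamB + mu)) :=
    measurePreserving_fst
  exact h3.comp (h2.comp h1)

lemma ae_elapsed_pos {lamA lamB mu : ℝ} (hA : 0 < lamA) (hB : 0 ≤ lamB) (hmu : 0 < mu) :
    ∀ᵐ w ∂(pathLaw lamA lamB mu), ∀ k, 0 < (w k).2.1 := by
  rw [ae_all_iff]
  intro k
  exact (measurePreserving_elapsed hA hB hmu k).quasiMeasurePreserving.ae
    (expMeasure_ae_pos (by positivity))

/-- Event and elapsed time are independent, and the random number is irrelevant to functions of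
these two. -/
lemma integral_epochLaw_mul {lamA lamB mu : ℝ} (hA : 0 < lamA) (hB : 0 ≤ lamB)
    (hmu : 0 < mu) (f : Event → ℝ) (g : ℝ → ℝ) :
    ∫ b, f b.1 * g b.2.1 ∂(epochLaw lamA lamB mu)
      = (∫ e, f e ∂(eventLaw lamA lamB mu)) * ∫ x, g x ∂(expMeasure (lamA + lamB + mu)) := by
  have := isProbabilityMeasure_eventLaw hA hB hmu
  have := isProbabilityMeasure_expMeasure (show 0 < lamA + lamB + mu by positivity)
  rw [epochLaw, integral_prod_mul (μ := eventLaw lamA lamB mu)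
    (ν := (expMeasure (lamA + lamB + mu)).prod volume) f (fun z : ℝ × unitInterval => g z.1)]
  congr 1
  have := integral_prod_mul (μ := expMeasure (lamA + lamB + mu))
    (ν := (volume : Measure unitInterval)) g (fun _ => 1)
  simpa using this

/-! ### Event times -/

/-- The indicator function of the `(k+1)`-st event occurring up to time `T`. -/
noncomputable def occurs (T : ℝ) (k : ℕ) (w : Path) : ℝ :=
  if eventTime w (k + 1) ≤ T then 1 else 0

/-- The time that elapses up to time `T` between the `k`-th and the `(k+1)`-st event. -/
noncomputable def dwell (T : ℝ) (k : ℕ) (w : Path) : ℝ :=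
  min (eventTime w (k + 1)) T - min (eventTime w k) T

lemma measurable_eventTime (k : ℕ) : Measurable (fun w => eventTime w k) := by
  unfold eventTime
  exact Finset.measurable_sum _ fun i _ => (measurable_pi_apply i).snd.fst

lemma eventTime_succ (w : Path) (k : ℕ) : eventTime w (k + 1) = eventTime w k + (w k).2.1 :=
  Finset.sum_range_succ _ _

lemma eventTime_update (w : Path) (k : ℕ) (b : Epoch) :
    eventTime (Function.update w k b) k = eventTime w k := by
  refine Finset.sum_congr rfl fun i hi => ?_
  rw [Function.update_of_ne (Finset.mem_range.mp hi).ne]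

lemma measurable_occurs (T : ℝ) (k : ℕ) : Measurable (occurs T k) :=
  Measurable.ite (measurableSet_le (measurable_eventTime _) measurable_const)
    measurable_const measurable_const

lemma measurable_dwell (T : ℝ) (k : ℕ) : Measurable (dwell T k) :=
  ((measurable_eventTime _).min measurable_const).sub
    ((measurable_eventTime _).min measurable_const)

lemma occurs_nonneg (T : ℝ) (k : ℕ) (w : Path) : 0 ≤ occurs T k w := by
  unfold occurs; split_ifs <;> norm_num

lemma norm_occurs_le (T : ℝ) (k : ℕ) (w : Path) : ‖occurs T k w‖ ≤ 1 := by
  unfold occurs; split_ifs <;> norm_num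

lemma strictMono_eventTime {w : Path} (hw : ∀ k, 0 < (w k).2.1) :
    StrictMono (eventTime w) :=
  strictMono_nat_of_lt_succ fun k => by rw [eventTime_succ]; linarith [hw k]

lemma eventTime_nonneg {w : Path} (hw : ∀ k, 0 < (w k).2.1) (k : ℕ) : 0 ≤ eventTime w k :=
  Finset.sum_nonneg fun i _ => (hw i).le

lemma dwell_nonneg {w : Path} (hw : ∀ k, 0 < (w k).2.1) (T : ℝ) (k : ℕ) : 0 ≤ dwell T k w :=
  sub_nonneg.mpr (min_le_min_right _ ((strictMono_eventTime hw).monotone (Nat.le_succ k)))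

lemma dwell_le {w : Path} (hw : ∀ k, 0 < (w k).2.1) {T : ℝ} (hT : 0 ≤ T) (k : ℕ) :
    dwell T k w ≤ T := by
  have h1 : 0 ≤ min (eventTime w k) T := le_min (eventTime_nonneg hw k) hT
  have h2 : min (eventTime w (k + 1)) T ≤ T := min_le_right _ _
  unfold dwell; linarith

/-! ### Compensation formula and tails of the number of events -/

section Compensation

variable {lamA lamB mu : ℝ}

lemma integrable_occurs_mul (hA : 0 < lamA) (hB : 0 ≤ lamB) (hmu : 0 < mu)
    (T : ℝ) (k : ℕ) {f : Path → ℝ} (hf : Measurable f) {M : ℝ} (hM : ∀ w, |f w| ≤ M) :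
    Integrable (fun w => occurs T k w * f w) (pathLaw lamA lamB mu) := by
  have := isProbabilityMeasure_pathLaw hA hB hmu
  refine Integrable.of_bound (C := M) ((measurable_occurs T k).mul hf).aestronglyMeasurable ?_
  refine Eventually.of_forall fun w => ?_
  rw [norm_mul]
  exact (mul_le_of_le_one_left (norm_nonneg _) (norm_occurs_le T k w)).trans (hM w)

lemma integrable_dwell_mul (hA : 0 < lamA) (hB : 0 ≤ lamB) (hmu : 0 < mu)
    {T : ℝ} (hT : 0 ≤ T) (k : ℕ) {f : Path → ℝ} (hf : Measurable f) {M : ℝ}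
    (hM : ∀ w, |f w| ≤ M) :
    Integrable (fun w => dwell T k w * f w) (pathLaw lamA lamB mu) := by
  have := isProbabilityMeasure_pathLaw hA hB hmu
  refine Integrable.of_bound (C := T * M) ((measurable_dwell T k).mul hf).aestronglyMeasurable ?_
  filter_upwards [ae_elapsed_pos hA hB hmu] with w hw
  rw [norm_mul, Real.norm_of_nonneg (dwell_nonneg hw T k)]
  exact mul_le_mul (dwell_le hw hT k) (hM w) (norm_nonneg _) hT

lemma measurable_uncurry_event {f : Event → Path → ℝ} (hf : ∀ e, Measurable (f e)) (k : ℕ) :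
    Measurable (fun w : Path => f (w k).1 w) := by
  have h : Measurable (fun p : Event × Path => f p.1 p.2) :=
    measurable_from_prod_countable_right fun e => hf e
  exact h.comp ((measurable_pi_apply k).fst.prodMk measurable_id)

/-- Compensation formula: the expectation of a reward at the `(k+1)`-st event is that of the
corresponding reward rate during the preceding time interval. -/
lemma integral_occurs_mul (hA : 0 < lamA) (hB : 0 ≤ lamB) (hmu : 0 < mu)
    {T : ℝ} (hT : 0 ≤ T) (k : ℕ) {f : Event → Path → ℝ} (hf : ∀ e, Measurable (f e)) {M : ℝ}
    (hM : ∀ e w, |f e w| ≤ M) (hk : ∀ e w b, f e (Function.update w k b) = f e w) :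
    ∫ w, occurs T k w * f (w k).1 w ∂(pathLaw lamA lamB mu)
      = ∫ w, dwell T k w * rateSum lamA lamB mu (fun e => f e w) ∂(pathLaw lamA lamB mu) := by
  have hL : 0 < lamA + lamB + mu := by positivity
  have := isProbabilityMeasure_eventLaw hA hB hmu
  have := isProbabilityMeasure_expMeasure hL
  have hr : Measurable (fun w => rateSum lamA lamB mu (fun e => f e w)) := by
    unfold rateSum
    exact (((hf _).const_mul _).add ((hf _).const_mul _)).add ((hf _).const_mul _)
  have hrb : ∀ w, |rateSum lamA lamB mu (fun e => f e w)| ≤ (lamA + lamB + mu) * M := by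
    intro w
    unfold rateSum
    have h1 := abs_le.mp (hM Event.arrivalA w)
    have h2 := abs_le.mp (hM Event.arrivalB w)
    have h3 := abs_le.mp (hM Event.service w)
    rw [abs_le]
    constructor <;> nlinarith
  -- Both sides are averaged over step `k` alone. Event and waiting time then separate, and the
  -- memoryless identity matches the two waiting-time factors.
  rw [integral_pathLaw_update hA hB hmu k
      (integrable_occurs_mul hA hB hmu T k (measurable_uncurry_event hf k) fun w => hM _ w),
    integral_pathLaw_update hA hB hmu k (integrable_dwell_mul hA hB hmu hT k hr hrb)]
  congr 1
  ext w
  have h1 : ∀ b : Epoch, occurs T k (Function.update w k b)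
      * f ((Function.update w k b) k).1 (Function.update w k b)
      = f b.1 w * ({x : ℝ | eventTime w k + x ≤ T}.indicator (fun _ => (1 : ℝ)) b.2.1) := by
    intro b
    rw [hk, Function.update_self, mul_comm, occurs, eventTime_succ, eventTime_update,
      Function.update_self, Set.indicator_apply]
    rfl
  have h2 : ∀ b : Epoch, dwell T k (Function.update w k b)
      * rateSum lamA lamB mu (fun e => f e (Function.update w k b))
      = rateSum lamA lamB mu (fun e => f e w)
        * (min (eventTime w k + b.2.1) T - min (eventTime w k) T) := by
    intro b
    simp only [hk]
    rw [mul_comm, dwell, eventTime_succ, eventTime_update, Function.update_self]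
  simp only [h1, h2]
  have hms : MeasurableSet {x : ℝ | eventTime w k + x ≤ T} :=
    measurableSet_le (by fun_prop) measurable_const
  rw [integral_epochLaw_mul hA hB hmu (fun e => f e w), ← integral_eventLaw hA hB hmu,
    integral_indicator_const _ hms, ← integral_min_sub_min_expMeasure hL,
    integral_epochLaw_mul hA hB hmu (fun _ => (lamA + lamB + mu) * ∫ e, f e w ∂_)
      (fun x => min (eventTime w k + x) T - min (eventTime w k) T)]
  simp
  ring

lemma integral_occurs (hA : 0 < lamA) (hB : 0 ≤ lamB) (hmu : 0 < mu)
    {T : ℝ} (hT : 0 ≤ T) (k : ℕ) :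
    ∫ w, occurs T k w ∂(pathLaw lamA lamB mu)
      = (lamA + lamB + mu) * ∫ w, dwell T k w ∂(pathLaw lamA lamB mu) := by
  have h := integral_occurs_mul hA hB hmu hT k (f := fun _ _ => 1) (M := 1)
    (fun _ => measurable_const) (by simp) (by simp)
  simp only [mul_one, rateSum] at h
  rw [h, integral_mul_const, mul_comm]

/-- Waiting times are independent, so each of them contributes a factor `1 / 2`. -/
lemma integral_exp_neg_eventTime (hA : 0 < lamA) (hB : 0 ≤ lamB) (hmu : 0 < mu) (k : ℕ) :
    Integrable (fun w => Real.exp (-((lamA + lamB + mu) * eventTime w k)))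
        (pathLaw lamA lamB mu) ∧
      ∫ w, Real.exp (-((lamA + lamB + mu) * eventTime w k)) ∂(pathLaw lamA lamB mu)
        = (1 / 2) ^ k := by
  have hL : 0 < lamA + lamB + mu := by positivity
  have := isProbabilityMeasure_eventLaw hA hB hmu
  have := isProbabilityMeasure_pathLaw hA hB hmu
  have hint : ∀ k, Integrable (fun w => Real.exp (-((lamA + lamB + mu) * eventTime w k)))
      (pathLaw lamA lamB mu) := by
    intro k
    refine Integrable.of_bound (C := 1)
      (((measurable_eventTime k).const_mul _).neg.exp).aestronglyMeasurable ?_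
    filter_upwards [ae_elapsed_pos hA hB hmu] with w hw
    rw [Real.norm_of_nonneg (Real.exp_nonneg _), Real.exp_le_one_iff]
    have := eventTime_nonneg hw k
    have := mul_nonneg hL.le this
    linarith
  refine ⟨hint k, ?_⟩
  induction k with
  | zero => simp [eventTime]
  | succ k ih =>
    rw [integral_pathLaw_update hA hB hmu k (hint (k + 1))]
    have h1 : ∀ w : Path, ∀ b : Epoch,
        Real.exp (-((lamA + lamB + mu) * eventTime (Function.update w k b) (k + 1)))
          = Real.exp (-((lamA + lamB + mu) * eventTime w k))
            * Real.exp (-((lamA + lamB + mu) * b.2.1)) := by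
      intro w b
      rw [eventTime_succ, eventTime_update, Function.update_self, ← Real.exp_add]
      congr 1; ring
    simp only [h1]
    have h2 : ∀ w : Path, ∫ b, Real.exp (-((lamA + lamB + mu) * eventTime w k))
            * Real.exp (-((lamA + lamB + mu) * b.2.1)) ∂(epochLaw lamA lamB mu)
          = Real.exp (-((lamA + lamB + mu) * eventTime w k)) * (1 / 2) := by
      intro w
      rw [integral_epochLaw_mul hA hB hmu
        (fun _ => Real.exp (-((lamA + lamB + mu) * eventTime w k)))
        (fun x => Real.exp (-((lamA + lamB + mu) * x))), integral_exp_neg_mul_expMeasure hL]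
      simp
    simp only [h2]
    rw [integral_mul_const, ih, pow_succ]

/-- The number of events up to time `T` has geometric tails. -/
lemma integral_occurs_le (hA : 0 < lamA) (hB : 0 ≤ lamB) (hmu : 0 < mu) (T : ℝ) (k : ℕ) :
    ∫ w, occurs T k w ∂(pathLaw lamA lamB mu)
      ≤ Real.exp ((lamA + lamB + mu) * T) * (1 / 2) ^ k := by
  have hL : 0 < lamA + lamB + mu := by positivity
  have := isProbabilityMeasure_pathLaw hA hB hmu
  obtain ⟨h1, h2⟩ := integral_exp_neg_eventTime hA hB hmu (k + 1)
  -- Chernoff bound: the indicator of `S ≤ T` is at most `exp (L * (T - S))`, with `L` the total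
  -- rate.
  have h3 : ∫ w, occurs T k w ∂(pathLaw lamA lamB mu) ≤
      ∫ w, Real.exp ((lamA + lamB + mu) * T)
        * Real.exp (-((lamA + lamB + mu) * eventTime w (k + 1))) ∂(pathLaw lamA lamB mu) := by
    refine integral_mono ?_ (h1.const_mul _) fun w => ?_
    · simpa using integrable_occurs_mul hA hB hmu T k (f := fun _ => 1) measurable_const
        (M := 1) (by simp)
    · simp only [← Real.exp_add]
      unfold occurs
      split_ifs with h
      · rw [← Real.exp_zero]
        apply Real.exp_le_exp.mpr
        nlinarith
      · positivity
  rw [integral_const_mul, h2] at h3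
  refine h3.trans ?_
  exact mul_le_mul_of_nonneg_left
    (pow_le_pow_of_le_one (by norm_num) (by norm_num) (Nat.le_succ k)) (Real.exp_nonneg _)

end Compensation

/-! ### Sums of integrable functions -/

/-- Summability of the `L¹` norms allows the exchange of sum and integral. The sum is required only
almost everywhere because the path identities fail on a null set. -/
lemma integrable_and_hasSum_integral {α : Type*} {m : MeasurableSpace α} {P : Measure α}
    {F : ℕ → α → ℝ} {f : α → ℝ} (hF : ∀ i, Integrable (F i) P)
    (hs : Summable fun i => ∫ a, ‖F i a‖ ∂P) (hf : ∀ᵐ a ∂P, HasSum (fun i => F i a) (f a)) :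
    Integrable f P ∧ HasSum (fun i => ∫ a, F i a ∂P) (∫ a, f a ∂P) := by
  constructor
  · refine ⟨aestronglyMeasurable_of_tendsto_ae atTop
      (f := fun K a => ∑ i ∈ Finset.range K, F i a)
      (fun K => (integrable_finsetSum _ fun i _ => hF i).aestronglyMeasurable) ?_, ?_⟩
    · filter_upwards [hf] with a ha using ha.tendsto_sum_nat
    · have h1 : ∫⁻ a, ‖f a‖ₑ ∂P ≤ ∫⁻ a, ∑' i, ‖F i a‖ₑ ∂P := by
        refine lintegral_mono_ae ?_
        filter_upwards [hf] with a ha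
        rw [← ha.tsum_eq]
        exact enorm_tsum_le_tsum_enorm
      refine h1.trans_lt ?_
      rw [lintegral_tsum fun i => (hF i).aestronglyMeasurable.enorm]
      have h2 : ∀ i, ∫⁻ a, ‖F i a‖ₑ ∂P = ENNReal.ofReal (∫ a, ‖F i a‖ ∂P) := fun i =>
        (ofReal_integral_norm_eq_lintegral_enorm (hF i)).symm
      simp only [h2]
      rw [← ENNReal.ofReal_tsum_of_nonneg (fun i => integral_nonneg fun a => norm_nonneg _) hs]
      exact ENNReal.ofReal_lt_top
  · have h := hasSum_integral_of_summable_integral_norm (E := ℝ) hF hs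
    have h2 : ∫ a, ∑' i, F i a ∂P = ∫ a, f a ∂P :=
      integral_congr_ae (hf.mono fun a ha => ha.tsum_eq)
    rwa [h2] at h

/-! ### The state process -/

section StateProcess

variable {σ τ : Strategy} {s₀ : ℕ × ℕ}

lemma state_succ (w : Path) (k : ℕ) :
    state σ τ s₀ w (k + 1)
      = (min (afterEvent (w k).1 (state σ τ s₀ w k)).1
          (σ.keep k (fun i => w i) (afterEvent (w k).1 (state σ τ s₀ w k))),
        min (afterEvent (w k).1 (state σ τ s₀ w k)).2
          (τ.keep k (fun i => w i) (afterEvent (w k).1 (state σ τ s₀ w k)))) := rfl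

/-- Strategies do not anticipate. Hence the state before an event is unaffected by resampling that
event, as the compensation formula demands. -/
lemma state_congr {w w' : Path} (k : ℕ) (h : ∀ i < k, w i = w' i) :
    state σ τ s₀ w k = state σ τ s₀ w' k := by
  induction k with
  | zero => rfl
  | succ k ih =>
    have h1 : (fun i : Fin (k + 1) => w i) = fun i : Fin (k + 1) => w' i :=
      funext fun i => h i i.2
    rw [state_succ, state_succ, ih fun i hi => h i (by omega), h1, h k (Nat.lt_succ_self k)]

lemma state_update (w : Path) (k : ℕ) (b : Epoch) :
    state σ τ s₀ (Function.update w k b) k = state σ τ s₀ w k :=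
  state_congr k fun _ hi => Function.update_of_ne hi.ne _ _

lemma measurable_state (k : ℕ) : Measurable (fun w => state σ τ s₀ w k) := by
  induction k with
  | zero => exact measurable_const
  | succ k ih =>
    have hh : Measurable (fun w : Path => fun i : Fin (k + 1) => w i) :=
      measurable_pi_lambda _ fun i => measurable_pi_apply _
    have hs : Measurable (fun w => afterEvent (w k).1 (state σ τ s₀ w k)) := by
      have h : Measurable (fun p : (ℕ × ℕ) × Event => afterEvent p.2 p.1) :=
        measurable_of_countable _
      exact h.comp (ih.prodMk (measurable_pi_apply k).fst)
    have hk : ∀ ρ : Strategy, Measurable (fun w : Path =>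
        ρ.keep k (fun i => w i) (afterEvent (w k).1 (state σ τ s₀ w k))) := by
      intro ρ
      have h : Measurable (fun p : (Fin (k + 1) → Epoch) × (ℕ × ℕ) => ρ.keep k p.1 p.2) :=
        measurable_from_prod_countable_left fun s => ρ.measurable_keep k s
      exact h.comp (hh.prodMk hs)
    simp only [state_succ]
    exact (hs.fst.min (hk σ)).prodMk (hs.snd.min (hk τ))

lemma afterEvent_fst_le (e : Event) (s : ℕ × ℕ) : (afterEvent e s).1 ≤ s.1 + 1 := by
  cases e <;> simp only [afterEvent] <;> (try split_ifs) <;> grind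

lemma state_fst_le (w : Path) (k : ℕ) : (state σ τ s₀ w k).1 ≤ s₀.1 + k := by
  induction k with
  | zero => exact le_rfl
  | succ k ih =>
    rw [state_succ]
    have := afterEvent_fst_le (w k).1 (state σ τ s₀ w k)
    exact (min_le_left _ _).trans (by omega)

end StateProcess

/-! ### Path identities -/

/-- Event times increase strictly, so the events up to `t` form an initial segment. Excluding
explosion matters: `Set.ncard` of an infinite set is `0`. -/
lemma lt_eventCount_iff {w : Path} (hw : ∀ k, 0 < (w k).2.1) {t : ℝ}
    (ht : ∃ k, t < eventTime w (k + 1)) (k : ℕ) :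
    k < eventCount w t ↔ eventTime w (k + 1) ≤ t := by
  classical
  have hmono := strictMono_eventTime hw
  have hset : {k : ℕ | eventTime w (k + 1) ≤ t} = Set.Iio (Nat.find ht) := by
    ext j
    simp only [Set.mem_ofPred_eq, Set.mem_Iio, Nat.lt_find_iff, not_lt]
    constructor
    · intro h i hi
      exact (hmono.monotone (by omega)).trans h
    · intro h
      exact h j le_rfl
  have hN : eventCount w t = Nat.find ht := by
    rw [eventCount, hset, ← Finset.coe_Iio, Set.ncard_coe_finset, Nat.card_Iio]
  rw [hN, ← Set.mem_Iio, ← hset]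
  rfl

lemma eventCount_eq {w : Path} (hw : ∀ k, 0 < (w k).2.1) {t : ℝ} {k : ℕ}
    (h1 : eventTime w k ≤ t) (h2 : t < eventTime w (k + 1)) : eventCount w t = k := by
  have h := lt_eventCount_iff hw ⟨k, h2⟩
  apply le_antisymm
  · by_contra hc
    exact absurd ((h k).mp (not_le.mp hc)) (not_le.mpr h2)
  · rcases k with _ | k
    · exact Nat.zero_le _
    · exact (h k).mpr h1

lemma occurs_eq {w : Path} (hw : ∀ k, 0 < (w k).2.1) {T : ℝ}
    (hT : ∃ k, T < eventTime w (k + 1)) (k : ℕ) :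
    occurs T k w = if k < eventCount w T then 1 else 0 := by
  simp only [occurs, lt_eventCount_iff hw hT]

lemma min_eventTime_eq {w : Path} (hw : ∀ k, 0 < (w k).2.1) {T : ℝ}
    (hT : ∃ k, T < eventTime w (k + 1)) {k : ℕ} (hk : eventCount w T < k) :
    min (eventTime w k) T = T := by
  obtain ⟨j, rfl⟩ : ∃ j, k = j + 1 := ⟨k - 1, by omega⟩
  have := mt (lt_eventCount_iff hw hT j).mpr (by omega)
  exact min_eq_right (not_le.mp this).le

lemma dwell_eq_zero {w : Path} (hw : ∀ k, 0 < (w k).2.1) {T : ℝ}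
    (hT : ∃ k, T < eventTime w (k + 1)) {k : ℕ} (hk : eventCount w T < k) :
    dwell T k w = 0 := by
  rw [dwell, min_eventTime_eq hw hT hk, min_eventTime_eq hw hT (by omega), sub_self]

lemma hasSum_dwell {w : Path} (hw : ∀ k, 0 < (w k).2.1) {T : ℝ} (h0 : 0 ≤ T)
    (hT : ∃ k, T < eventTime w (k + 1)) : HasSum (fun k => dwell T k w) T := by
  have h := hasSum_sum_of_ne_finset_zero (f := fun k => dwell T k w)
    (L := .unconditional ℕ)
    (s := Finset.range (eventCount w T + 1))
    (fun k hk => dwell_eq_zero hw hT (by simpa using hk))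
  have h2 : ∑ k ∈ Finset.range (eventCount w T + 1), dwell T k w = T := by
    unfold dwell
    rw [Finset.sum_range_sub (fun k => min (eventTime w k) T),
      min_eventTime_eq hw hT (Nat.lt_succ_self _)]
    simp [eventTime, h0]
  rwa [h2] at h

lemma integral_comp_eventCount {w : Path} (hw : ∀ k, 0 < (w k).2.1) {T : ℝ} (h0 : 0 ≤ T)
    (hT : ∃ k, T < eventTime w (k + 1)) (f : ℕ → ℝ) :
    ∫ t in (0 : ℝ)..T, f (eventCount w t)
      = ∑ k ∈ Finset.range (eventCount w T + 1), f k * dwell T k w := by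
  have hmono := strictMono_eventTime hw
  -- Truncation at `T` gives consecutive intervals that exactly fill `[0, T]`. The count is constant
  -- on each except at its right endpoint, a null set.
  set a : ℕ → ℝ := fun k => min (eventTime w k) T with ha
  have hle : ∀ k, a k ≤ a (k + 1) := fun k =>
    min_le_min_right _ (hmono.monotone (Nat.le_succ k))
  have hae : ∀ k, ∀ᵐ t : ℝ, t ∈ Set.uIoc (a k) (a (k + 1)) → f (eventCount w t) = f k := by
    intro k
    have hne : ∀ᵐ t : ℝ, t ≠ a (k + 1) := by simp [ae_iff]
    filter_upwards [hne] with t ht1 ht2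
    rw [Set.uIoc_of_le (hle k), Set.mem_Ioc] at ht2
    have h3 : t < a (k + 1) := lt_of_le_of_ne ht2.2 ht1
    have h4 : t < eventTime w (k + 1) := h3.trans_le (min_le_left _ _)
    have h5 : t < T := h3.trans_le (min_le_right _ _)
    have h6 : eventTime w k ≤ t := by
      by_contra hc
      have : t < a k := lt_min (not_le.mp hc) h5
      exact absurd ht2.1 (not_lt.mpr this.le)
    rw [eventCount_eq hw h6 h4]
  have hint : ∀ k, IntervalIntegrable (fun t => f (eventCount w t)) volume (a k) (a (k + 1)) := by
    intro k
    refine (intervalIntegrable_const (c := f k)).congr_ae ?_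
    rw [Filter.EventuallyEq, ae_restrict_iff' measurableSet_uIoc]
    filter_upwards [hae k] with t ht h using (ht h).symm
  have hsum := intervalIntegral.sum_integral_adjacent_intervals (a := a)
    (n := eventCount w T + 1) fun k _ => hint k
  have ha0 : a 0 = 0 := by simp [ha, eventTime, h0]
  have haN : a (eventCount w T + 1) = T := min_eventTime_eq hw hT (Nat.lt_succ_self _)
  rw [ha0, haN] at hsum
  rw [← hsum]
  refine Finset.sum_congr rfl fun k _ => ?_
  rw [intervalIntegral.integral_congr_ae (hae k), intervalIntegral.integral_const, smul_eq_mul,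
    mul_comm]
  rfl

open Classical in
/-- The part of the net benefit that accrues between the `k`-th event (exclusive) and the
`(k+1)`-st event (inclusive). -/
noncomputable def stepBenefit (RA CA : ℝ) (σ τ : Strategy) (s₀ : ℕ × ℕ) (T : ℝ) (k : ℕ)
    (w : Path) : ℝ :=
  occurs T k w * (if (w k).1 = Event.service ∧ 0 < (state σ τ s₀ w k).1 then RA else 0)
    - dwell T k w * (CA * ((state σ τ s₀ w k).1 : ℝ))

lemma hasSum_stepBenefit (RA CA : ℝ) (σ τ : Strategy) (s₀ : ℕ × ℕ) {w : Path}
    (hw : ∀ k, 0 < (w k).2.1) {T : ℝ} (h0 : 0 ≤ T) (hT : ∃ k, T < eventTime w (k + 1)) :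
    HasSum (fun k => stepBenefit RA CA σ τ s₀ T k w) (netBenefitA RA CA σ τ s₀ T w) := by
  have h := hasSum_sum_of_ne_finset_zero (f := fun k => stepBenefit RA CA σ τ s₀ T k w)
    (L := .unconditional ℕ)
    (s := Finset.range (eventCount w T + 1)) (fun k hk => by
      have hk' : eventCount w T < k := by simpa using hk
      rw [stepBenefit, dwell_eq_zero hw hT hk', occurs_eq hw hT, if_neg (by omega)]
      simp)
  convert h using 1
  have hi := integral_comp_eventCount hw h0 hT (fun k => ((state σ τ s₀ w k).1 : ℝ))
  simp only [netBenefitA, customersA, hi, stepBenefit, Finset.sum_sub_distrib]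
  congr 1
  -- The last interval is cut off by `T`: it carries waiting cost but no event, so its reward term
  -- drops out.
  · rw [servedA, Finset.card_filter, Finset.sum_range_succ, occurs_eq hw hT,
      if_neg (lt_irrefl _), zero_mul, add_zero, Nat.cast_sum, Finset.mul_sum]
    refine Finset.sum_congr rfl fun k hk => ?_
    rw [occurs_eq hw hT, if_pos (Finset.mem_range.mp hk)]
    split_ifs <;> simp
  · rw [Finset.mul_sum]
    refine Finset.sum_congr rfl fun k _ => by ring

lemma sum_occurs_mul_sub {w : Path} (hw : ∀ k, 0 < (w k).2.1) {T : ℝ}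
    (hT : ∃ k, T < eventTime w (k + 1)) (a : ℕ → ℝ) (K : ℕ) :
    ∑ k ∈ Finset.range K, occurs T k w * (a (k + 1) - a k)
      = a (min K (eventCount w T)) - a 0 := by
  induction K with
  | zero => simp
  | succ K ih =>
    rw [Finset.sum_range_succ, ih, occurs_eq hw hT]
    split_ifs with h
    · rw [min_eq_left h.le, min_eq_left (by omega)]; ring
    · rw [min_eq_right (by omega), min_eq_right (by omega)]; ring

/-! ### The expected net benefit -/

section ExpectedBenefit

variable {lamA lamB mu : ℝ}

/-- Explosion before `T` forces every event to occur by then, and the probability of the `k`-th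
doing so tends to `0` geometrically. -/
lemma ae_exists_lt_eventTime (hA : 0 < lamA) (hB : 0 ≤ lamB) (hmu : 0 < mu) (T : ℝ) :
    ∀ᵐ w ∂(pathLaw lamA lamB mu), ∃ k, T < eventTime w (k + 1) := by
  have := isProbabilityMeasure_pathLaw hA hB hmu
  set P := pathLaw lamA lamB mu
  set c := Real.exp ((lamA + lamB + mu) * T)
  have hm : ∀ k, MeasurableSet {w : Path | eventTime w (k + 1) ≤ T} := fun k =>
    measurableSet_le (measurable_eventTime _) measurable_const
  have hle : ∀ k, P.real {w | ¬ ∃ k, T < eventTime w (k + 1)} ≤ c * (1 / 2) ^ k := by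
    intro k
    refine le_trans ?_ (integral_occurs_le hA hB hmu T k)
    have h1 : ∫ w, occurs T k w ∂P = P.real {w : Path | eventTime w (k + 1) ≤ T} := by
      rw [← integral_indicator_one (hm k)]
      rfl
    rw [h1]
    refine measureReal_mono fun w hw => ?_
    simp only [Set.mem_ofPred_eq, not_exists, not_lt] at hw ⊢
    exact hw k
  have hlim : Tendsto (fun k : ℕ => c * (1 / 2 : ℝ) ^ k) atTop (nhds 0) := by
    simpa using (tendsto_pow_atTop_nhds_zero_of_lt_one (r := (1 / 2 : ℝ)) (by norm_num)
      (by norm_num)).const_mul c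
  have h0 : P.real {w | ¬ ∃ k, T < eventTime w (k + 1)} = 0 :=
    le_antisymm (ge_of_tendsto' hlim hle) measureReal_nonneg
  rw [ae_iff]
  exact (measureReal_eq_zero_iff).mp h0

variable {RA CA : ℝ} {σ τ : Strategy} {s₀ : ℕ × ℕ} {T : ℝ}

lemma measurable_comp_state_fst {β : Type*} [MeasurableSpace β] (f : ℕ → β) (k : ℕ) :
    Measurable (fun w => f (state σ τ s₀ w k).1) :=
  (measurable_from_top (f := f)).comp (measurable_state k).fst

/-- A function of the number of customers is bounded at every fixed step. -/
lemma exists_bound_state_fst (σ τ : Strategy) (s₀ : ℕ × ℕ) (f : ℕ → ℝ) (k : ℕ) :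
    ∃ M, ∀ w, |f (state σ τ s₀ w k).1| ≤ M := by
  refine ⟨∑ n ∈ Finset.range (s₀.1 + k + 1), |f n|, fun w => ?_⟩
  exact Finset.single_le_sum (f := fun n => |f n|) (fun _ _ => abs_nonneg _)
    (Finset.mem_range.mpr (Nat.lt_succ_of_le (state_fst_le w k)))

lemma exists_bound_event_state_fst (σ τ : Strategy) (s₀ : ℕ × ℕ) (f : Event → ℕ → ℝ) (k : ℕ) :
    ∃ M, ∀ e w, |f e (state σ τ s₀ w k).1| ≤ M := by
  choose M hM using fun e => exists_bound_state_fst σ τ s₀ (f e) k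
  refine ⟨max (M Event.arrivalA) (max (M Event.arrivalB) (M Event.service)), fun e w => ?_⟩
  cases e
  · exact (hM _ w).trans (le_max_left _ _)
  · exact (hM _ w).trans ((le_max_left _ _).trans (le_max_right _ _))
  · exact (hM _ w).trans ((le_max_right _ _).trans (le_max_right _ _))

lemma integrable_occurs_mul_state (hA : 0 < lamA) (hB : 0 ≤ lamB) (hmu : 0 < mu)
    (f : Event → ℕ → ℝ) (k : ℕ) :
    Integrable (fun w => occurs T k w * f (w k).1 (state σ τ s₀ w k).1)
      (pathLaw lamA lamB mu) := by
  obtain ⟨M, hM⟩ := exists_bound_event_state_fst σ τ s₀ f k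
  exact integrable_occurs_mul hA hB hmu T k
    (measurable_uncurry_event (f := fun e w => f e (state σ τ s₀ w k).1)
      (fun e => measurable_comp_state_fst (f e) k) k) fun w => hM _ w

lemma integrable_dwell_mul_state (hA : 0 < lamA) (hB : 0 ≤ lamB) (hmu : 0 < mu) (hT : 0 ≤ T)
    (f : ℕ → ℝ) (k : ℕ) :
    Integrable (fun w => dwell T k w * f (state σ τ s₀ w k).1) (pathLaw lamA lamB mu) := by
  obtain ⟨M, hM⟩ := exists_bound_state_fst σ τ s₀ f k
  exact integrable_dwell_mul hA hB hmu hT k (measurable_comp_state_fst f k) hM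

lemma integral_occurs_mul_state (hA : 0 < lamA) (hB : 0 ≤ lamB) (hmu : 0 < mu) (hT : 0 ≤ T)
    (f : Event → ℕ → ℝ) (k : ℕ) :
    ∫ w, occurs T k w * f (w k).1 (state σ τ s₀ w k).1 ∂(pathLaw lamA lamB mu)
      = ∫ w, dwell T k w * rateSum lamA lamB mu (fun e => f e (state σ τ s₀ w k).1)
          ∂(pathLaw lamA lamB mu) := by
  obtain ⟨M, hM⟩ := exists_bound_event_state_fst σ τ s₀ f k
  exact integral_occurs_mul hA hB hmu hT k (f := fun e w => f e (state σ τ s₀ w k).1)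
    (fun e => measurable_comp_state_fst (f e) k) hM fun e w b => by rw [state_update]

lemma integrable_occurs (hA : 0 < lamA) (hB : 0 ≤ lamB) (hmu : 0 < mu) (k : ℕ) :
    Integrable (occurs T k) (pathLaw lamA lamB mu) := by
  simpa using integrable_occurs_mul hA hB hmu T k (f := fun _ => 1) measurable_const
    (M := 1) (by simp)

lemma integrable_dwell (hA : 0 < lamA) (hB : 0 ≤ lamB) (hmu : 0 < mu) (hT : 0 ≤ T) (k : ℕ) :
    Integrable (dwell T k) (pathLaw lamA lamB mu) := by
  simpa using integrable_dwell_mul hA hB hmu hT k (f := fun _ => 1) measurable_const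
    (M := 1) (by simp)

lemma integral_dwell_le (hA : 0 < lamA) (hB : 0 ≤ lamB) (hmu : 0 < mu) (hT : 0 ≤ T) (k : ℕ) :
    ∫ w, dwell T k w ∂(pathLaw lamA lamB mu)
      ≤ Real.exp ((lamA + lamB + mu) * T) / (lamA + lamB + mu) * (1 / 2) ^ k := by
  have hL : 0 < lamA + lamB + mu := by positivity
  have h := integral_occurs_le hA hB hmu T k
  rw [integral_occurs hA hB hmu hT] at h
  rw [div_mul_eq_mul_div, le_div_iff₀ hL]
  linarith

lemma hasSum_integral_dwell (hA : 0 < lamA) (hB : 0 ≤ lamB) (hmu : 0 < mu) (hT : 0 ≤ T) :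
    HasSum (fun k => ∫ w, dwell T k w ∂(pathLaw lamA lamB mu)) T := by
  have := isProbabilityMeasure_pathLaw hA hB hmu
  have hpos := ae_elapsed_pos hA hB hmu
  have hnorm : ∀ k, ∫ w, ‖dwell T k w‖ ∂(pathLaw lamA lamB mu)
      = ∫ w, dwell T k w ∂(pathLaw lamA lamB mu) := fun k =>
    integral_congr_ae (hpos.mono fun w hw => Real.norm_of_nonneg (dwell_nonneg hw T k))
  have h := (integrable_and_hasSum_integral (f := fun _ => T)
    (integrable_dwell hA hB hmu hT (T := T)) ?_ ?_).2
  · simpa using h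
  · simp only [hnorm]
    refine Summable.of_nonneg_of_le
      (fun k => integral_nonneg_of_ae (hpos.mono fun w hw => dwell_nonneg hw T k))
      (integral_dwell_le hA hB hmu hT) ?_
    exact (summable_geometric_of_lt_one (by norm_num) (by norm_num)).mul_left _
  · filter_upwards [hpos, ae_exists_lt_eventTime hA hB hmu T] with w h1 h2
    exact hasSum_dwell h1 hT h2

open Classical in
/-- The reward for the given event when `n` customers of class `A` are present. -/
noncomputable def serviceReward (RA : ℝ) (e : Event) (n : ℕ) : ℝ :=
  if e = Event.service ∧ 0 < n then RA else 0

lemma stepBenefit_eq (k : ℕ) (w : Path) :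
    stepBenefit RA CA σ τ s₀ T k w
      = occurs T k w * serviceReward RA (w k).1 (state σ τ s₀ w k).1
        - dwell T k w * (CA * ((state σ τ s₀ w k).1 : ℝ)) := rfl

lemma integrable_stepBenefit (hA : 0 < lamA) (hB : 0 ≤ lamB) (hmu : 0 < mu) (hT : 0 ≤ T)
    (k : ℕ) : Integrable (stepBenefit RA CA σ τ s₀ T k) (pathLaw lamA lamB mu) :=
  (integrable_occurs_mul_state hA hB hmu (serviceReward RA) k).sub
    (integrable_dwell_mul_state hA hB hmu hT (fun n => CA * (n : ℝ)) k)

/-- The queue grows at most linearly in the number of events, whereas `k` events before `T` have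
geometrically small probability; `k * 2⁻ᵏ` is summable. -/
lemma summable_integral_norm_stepBenefit (hA : 0 < lamA) (hB : 0 ≤ lamB) (hmu : 0 < mu)
    (hT : 0 ≤ T) :
    Summable fun k => ∫ w, ‖stepBenefit RA CA σ τ s₀ T k w‖ ∂(pathLaw lamA lamB mu) := by
  have hL : 0 < lamA + lamB + mu := by positivity
  set E := Real.exp ((lamA + lamB + mu) * T) with hE
  have hEpos : 0 < E := Real.exp_pos _
  refine Summable.of_nonneg_of_le (fun k => integral_nonneg fun w => norm_nonneg _)
    (g := fun k => ∫ w, ‖stepBenefit RA CA σ τ s₀ T k w‖ ∂(pathLaw lamA lamB mu))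
    (f := fun k : ℕ => (|RA| * E + |CA| * s₀.1 * (E / (lamA + lamB + mu))) * (1 / 2 : ℝ) ^ k
      + |CA| * (E / (lamA + lamB + mu)) * ((k : ℝ) ^ 1 * (1 / 2 : ℝ) ^ k)) (fun k => ?_) ?_
  · have h1 : ∫ w, ‖stepBenefit RA CA σ τ s₀ T k w‖ ∂(pathLaw lamA lamB mu)
        ≤ ∫ w, (|RA| * occurs T k w + |CA| * (s₀.1 + k) * dwell T k w)
          ∂(pathLaw lamA lamB mu) := by
      refine integral_mono_ae (integrable_stepBenefit hA hB hmu hT k).norm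
        (((integrable_occurs hA hB hmu k).const_mul _).add
          ((integrable_dwell hA hB hmu hT k).const_mul _)) ?_
      filter_upwards [ae_elapsed_pos hA hB hmu] with w hw
      rw [stepBenefit_eq]
      refine (norm_sub_le _ _).trans (add_le_add ?_ ?_)
      · rw [norm_mul, Real.norm_of_nonneg (occurs_nonneg T k w), mul_comm]
        refine mul_le_mul_of_nonneg_right ?_ (occurs_nonneg T k w)
        unfold serviceReward
        split_ifs <;> simp
      · rw [norm_mul, Real.norm_of_nonneg (dwell_nonneg hw T k), mul_comm]
        refine mul_le_mul_of_nonneg_right ?_ (dwell_nonneg hw T k)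
        rw [norm_mul, Real.norm_natCast]
        refine mul_le_mul_of_nonneg_left ?_ (abs_nonneg _)
        exact_mod_cast state_fst_le w k
    rw [integral_add ((integrable_occurs hA hB hmu k).const_mul _)
      ((integrable_dwell hA hB hmu hT k).const_mul _), integral_const_mul,
      integral_const_mul] at h1
    have h2 := mul_le_mul_of_nonneg_left (integral_occurs_le hA hB hmu T k) (abs_nonneg RA)
    have h3 := mul_le_mul_of_nonneg_left (integral_dwell_le hA hB hmu hT k)
      (show 0 ≤ |CA| * (s₀.1 + k) by positivity)
    refine (h1.trans (add_le_add h2 h3)).trans (le_of_eq ?_)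
    ring
  · have g1 : Summable fun k : ℕ => (1 / 2 : ℝ) ^ k :=
      summable_geometric_of_lt_one (by norm_num) (by norm_num)
    have g2 : Summable fun k : ℕ => (k : ℝ) ^ 1 * (1 / 2 : ℝ) ^ k :=
      summable_pow_mul_geometric_of_norm_lt_one 1 (by norm_num)
    exact (g1.mul_left _).add (g2.mul_left _)

theorem integrable_netBenefitA_and_hasSum (hA : 0 < lamA) (hB : 0 ≤ lamB) (hmu : 0 < mu)
    (hT : 0 ≤ T) :
    Integrable (netBenefitA RA CA σ τ s₀ T) (pathLaw lamA lamB mu) ∧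
      HasSum (fun k => ∫ w, stepBenefit RA CA σ τ s₀ T k w ∂(pathLaw lamA lamB mu))
        (∫ w, netBenefitA RA CA σ τ s₀ T w ∂(pathLaw lamA lamB mu)) := by
  refine integrable_and_hasSum_integral (fun k => integrable_stepBenefit hA hB hmu hT k)
    (summable_integral_norm_stepBenefit hA hB hmu hT) ?_
  filter_upwards [ae_elapsed_pos hA hB hmu, ae_exists_lt_eventTime hA hB hmu T] with w h1 h2
  exact hasSum_stepBenefit RA CA σ τ s₀ h1 hT h2

/-- If `h` is bounded along the state process, and `f e n` bounds its value after event `e` in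
state `n` and satisfies the optimality inequality with gain `g`, then the expected net benefit is
at most `g * T`, up to a constant. -/
theorem integral_netBenefitA_le (hA : 0 < lamA) (hB : 0 ≤ lamB) (hmu : 0 < mu) (hT : 0 ≤ T)
    (h : ℕ → ℝ) (f : Event → ℕ → ℝ) (g M : ℝ)
    (hM : ∀ w k, |h (state σ τ s₀ w k).1| ≤ M)
    (hf : ∀ w k, h (state σ τ s₀ w (k + 1)).1 ≤ f (w k).1 (state σ τ s₀ w k).1)
    (hg : ∀ w k, rateSum lamA lamB mu (fun e => serviceReward RA e (state σ τ s₀ w k).1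
        + f e (state σ τ s₀ w k).1 - h (state σ τ s₀ w k).1)
          - CA * ((state σ τ s₀ w k).1 : ℝ) ≤ g) :
    ∫ w, netBenefitA RA CA σ τ s₀ T w ∂(pathLaw lamA lamB mu) ≤ g * T + 2 * M := by
  have := isProbabilityMeasure_pathLaw hA hB hmu
  set P := pathLaw lamA lamB mu with hP
  have hpos := ae_elapsed_pos hA hB hmu
  have hinc : ∀ k, Integrable (fun w => occurs T k w
      * (h (state σ τ s₀ w (k + 1)).1 - h (state σ τ s₀ w k).1)) P := fun k =>
    integrable_occurs_mul hA hB hmu T k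
      ((measurable_comp_state_fst h (k + 1)).sub (measurable_comp_state_fst h k))
      (M := M + M) fun w => (abs_sub _ _).trans (add_le_add (hM w _) (hM w _))
  -- Dynkin's formula for one step: after compensation, reward plus change of `h` is a rate per unit
  -- of time, bounded by `g`.
  have hstep : ∀ k, ∫ w, stepBenefit RA CA σ τ s₀ T k w ∂P
      + ∫ w, occurs T k w * (h (state σ τ s₀ w (k + 1)).1 - h (state σ τ s₀ w k).1) ∂P
      ≤ g * ∫ w, dwell T k w ∂P := by
    intro k
    let F : Event → ℕ → ℝ := fun e n => serviceReward RA e n + f e n - h n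
    have hF := integrable_occurs_mul_state (σ := σ) (τ := τ) (s₀ := s₀) (T := T) hA hB hmu F k
    have hC := integrable_dwell_mul_state (σ := σ) (τ := τ) (s₀ := s₀) hA hB hmu hT
      (fun n => CA * (n : ℝ)) k
    have hR := integrable_dwell_mul_state (σ := σ) (τ := τ) (s₀ := s₀) hA hB hmu hT
      (fun n => rateSum lamA lamB mu (fun e => F e n)) k
    calc _ = ∫ w, (stepBenefit RA CA σ τ s₀ T k w
            + occurs T k w * (h (state σ τ s₀ w (k + 1)).1 - h (state σ τ s₀ w k).1)) ∂P :=
          (integral_add (integrable_stepBenefit hA hB hmu hT k) (hinc k)).symm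
      _ ≤ ∫ w, (occurs T k w * F (w k).1 (state σ τ s₀ w k).1
            - dwell T k w * (CA * ((state σ τ s₀ w k).1 : ℝ))) ∂P := by
          refine integral_mono ((integrable_stepBenefit hA hB hmu hT k).add (hinc k))
            (hF.sub hC) fun w => ?_
          have h1 := mul_le_mul_of_nonneg_left (hf w k) (occurs_nonneg T k w)
          simp only [stepBenefit_eq, F]
          linarith
      _ = ∫ w, (dwell T k w * rateSum lamA lamB mu (fun e => F e (state σ τ s₀ w k).1)
            - dwell T k w * (CA * ((state σ τ s₀ w k).1 : ℝ))) ∂P := by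
          rw [integral_sub hF hC, integral_occurs_mul_state hA hB hmu hT F k,
            integral_sub hR hC]
      _ ≤ ∫ w, g * dwell T k w ∂P := by
          refine integral_mono_ae (hR.sub hC) ((integrable_dwell hA hB hmu hT k).const_mul g) ?_
          filter_upwards [hpos] with w hw
          have h1 := mul_le_mul_of_nonneg_left (hg w k) (dwell_nonneg hw T k)
          linarith
      _ = _ := integral_const_mul _ _
  -- The increments of `h` telescope along the path, so their total is bounded uniformly in `K`.
  have htele : ∀ K : ℕ, -(2 * M) ≤ ∑ k ∈ Finset.range K,
      ∫ w, occurs T k w * (h (state σ τ s₀ w (k + 1)).1 - h (state σ τ s₀ w k).1) ∂P := by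
    intro K
    rw [← integral_finsetSum _ fun k _ => hinc k]
    have h1 : ∫ _w, -(2 * M) ∂P = -(2 * M) := by simp
    rw [← h1]
    refine integral_mono_ae (integrable_const _) (integrable_finsetSum _ fun k _ => hinc k) ?_
    filter_upwards [hpos, ae_exists_lt_eventTime hA hB hmu T] with w hw hw2
    rw [sum_occurs_mul_sub hw hw2 (fun k => h (state σ τ s₀ w k).1)]
    have h2 := abs_le.mp (hM w (min K (eventCount w T)))
    have h3 := abs_le.mp (hM w 0)
    linarith
  have hpartial : ∀ K : ℕ, ∑ k ∈ Finset.range K, ∫ w, stepBenefit RA CA σ τ s₀ T k w ∂P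
      ≤ g * ∑ k ∈ Finset.range K, ∫ w, dwell T k w ∂P + 2 * M := by
    intro K
    have h1 := Finset.sum_le_sum fun k (_ : k ∈ Finset.range K) => hstep k
    rw [Finset.sum_add_distrib, ← Finset.mul_sum] at h1
    linarith [htele K]
  refine le_of_tendsto_of_tendsto'
    (integrable_netBenefitA_and_hasSum hA hB hmu hT).2.tendsto_sum_nat
    (((hasSum_integral_dwell hA hB hmu hT).tendsto_sum_nat.const_mul g).add_const (2 * M))
    hpartial

lemma netBenefitA_neg (w : Path) :
    netBenefitA (-RA) (-CA) σ τ s₀ T w = -netBenefitA RA CA σ τ s₀ T w := by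
  unfold netBenefitA; ring

lemma serviceReward_neg (e : Event) (n : ℕ) :
    serviceReward (-RA) e n = -serviceReward RA e n := by
  unfold serviceReward; split_ifs <;> simp

/-- The counterpart of `integral_netBenefitA_le` for equalities. -/
theorem abs_integral_netBenefitA_sub_le (hA : 0 < lamA) (hB : 0 ≤ lamB) (hmu : 0 < mu)
    (hT : 0 ≤ T) (h : ℕ → ℝ) (f : Event → ℕ → ℝ) (g M : ℝ)
    (hM : ∀ w k, |h (state σ τ s₀ w k).1| ≤ M)
    (hf : ∀ w k, h (state σ τ s₀ w (k + 1)).1 = f (w k).1 (state σ τ s₀ w k).1)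
    (hg : ∀ w k, rateSum lamA lamB mu (fun e => serviceReward RA e (state σ τ s₀ w k).1
        + f e (state σ τ s₀ w k).1 - h (state σ τ s₀ w k).1)
          - CA * ((state σ τ s₀ w k).1 : ℝ) = g) :
    |∫ w, netBenefitA RA CA σ τ s₀ T w ∂(pathLaw lamA lamB mu) - g * T| ≤ 2 * M := by
  have h1 := integral_netBenefitA_le hA hB hmu hT h f g M hM (fun w k => (hf w k).le)
    (fun w k => (hg w k).le)
  -- The upper bound is valid for rewards and costs of any sign; negating all data turns it into the
  -- lower bound.
  have h2 := integral_netBenefitA_le (RA := -RA) (CA := -CA) (σ := σ) (τ := τ) (s₀ := s₀)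
    hA hB hmu hT (fun n => -h n) (fun e n => -f e n) (-g) M (fun w k => by simpa using hM w k)
    (fun w k => (neg_inj.mpr (hf w k)).le) (fun w k => by
      rw [← hg w k]
      simp only [serviceReward_neg, rateSum]
      apply le_of_eq; ring)
  simp only [netBenefitA_neg, integral_neg] at h2
  rw [abs_le]
  constructor <;> linarith

end ExpectedBenefit

/-! ### The gains of the threshold strategies -/

section Gain

/-- `1 + r + ⋯ + r ^ m`. -/
def geomSum (r : ℝ) (m : ℕ) : ℝ := ∑ k ∈ Finset.range (m + 1), r ^ k

/-- `∑ r ^ k * (v - C * k)` over `1 ≤ k ≤ m`. -/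
def weightedBenefit (r v C : ℝ) : ℕ → ℝ
  | 0 => 0
  | m + 1 => weightedBenefit r v C m + r ^ (m + 1) * (v - C * (m + 1))

/-- The long-run net benefit per unit of time under the threshold strategy with threshold `m`. Here
`r` is the traffic intensity, `v` the reward per unit of service time, `C` the waiting cost. -/
noncomputable def gain (r v C : ℝ) (m : ℕ) : ℝ := weightedBenefit r v C m / geomSum r m

variable {r v C : ℝ}

lemma geomSum_succ (m : ℕ) : geomSum r (m + 1) = geomSum r m + r ^ (m + 1) :=
  Finset.sum_range_succ _ _

lemma one_le_geomSum (hr : 0 < r) (m : ℕ) : 1 ≤ geomSum r m := by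
  induction m with
  | zero => simp [geomSum]
  | succ m ih => rw [geomSum_succ]; linarith [pow_pos hr (m + 1)]

lemma gain_mul_geomSum (hr : 0 < r) (m : ℕ) :
    gain r v C m * geomSum r m = weightedBenefit r v C m :=
  div_mul_cancel₀ _ (by linarith [one_le_geomSum hr m])

lemma naorFunction_zero : naorFunction r 0 = 0 := by
  unfold naorFunction; split_ifs <;> simp

/-- Both branches are closed forms of the sum of `geomSum r j` over `j < m`; only this recursion
links the equation to the gains. -/
lemma naorFunction_natCast_succ (m : ℕ) :
    naorFunction r ((m + 1 : ℕ) : ℝ) = naorFunction r m + geomSum r m := by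
  unfold naorFunction
  split_ifs with h
  · subst h
    simp [geomSum]
    ring
  · have h1 : 1 - r ≠ 0 := sub_ne_zero.mpr (Ne.symm h)
    have h2 : geomSum r m * (1 - r) = 1 - r ^ (m + 1) := geom_sum_mul_neg r (m + 1)
    have h3 : geomSum r m = (1 - r ^ (m + 1)) / (1 - r) := by rw [← h2]; field_simp
    rw [h3, Real.rpow_natCast, Real.rpow_natCast]
    push_cast
    field_simp
    ring

/-- Passing to `m + 1` lowers either side by `C * geomSum r (m + 1)`, since the new term of
`weightedBenefit` cancels. -/
lemma geomSum_mul_sub_weightedBenefit (m : ℕ) :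
    geomSum r m * (v - C * (m + 1)) - weightedBenefit r v C m
      = v - C * naorFunction r ((m + 1 : ℕ) : ℝ) := by
  induction m with
  | zero =>
    rw [naorFunction_natCast_succ]
    simp [geomSum, weightedBenefit, naorFunction_zero]
  | succ m ih =>
    rw [naorFunction_natCast_succ, weightedBenefit, geomSum_succ]
    push_cast at ih ⊢
    linear_combination ih

lemma gain_succ_sub (hr : 0 < r) (m : ℕ) :
    (gain r v C (m + 1) - gain r v C m) * (geomSum r (m + 1) * geomSum r m)
      = r ^ (m + 1) * (v - C * naorFunction r ((m + 1 : ℕ) : ℝ)) := by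
  have h1 := gain_mul_geomSum (v := v) (C := C) hr m
  have h2 := gain_mul_geomSum (v := v) (C := C) hr (m + 1)
  rw [← geomSum_mul_sub_weightedBenefit, sub_mul,
    show gain r v C (m + 1) * (geomSum r (m + 1) * geomSum r m)
      = gain r v C (m + 1) * geomSum r (m + 1) * geomSum r m by ring,
    show gain r v C m * (geomSum r (m + 1) * geomSum r m)
      = gain r v C m * geomSum r m * geomSum r (m + 1) by ring, h1, h2, weightedBenefit,
    geomSum_succ]
  ring

lemma gain_lt_gain_succ_iff (hr : 0 < r) (hC : 0 < C) (m : ℕ) :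
    gain r v C m < gain r v C (m + 1) ↔ naorFunction r ((m + 1 : ℕ) : ℝ) < v / C := by
  have h := gain_succ_sub (v := v) (C := C) hr m
  have hS : 0 < geomSum r (m + 1) * geomSum r m :=
    mul_pos (by linarith [one_le_geomSum hr (m + 1)]) (by linarith [one_le_geomSum hr m])
  have hp := pow_pos hr (m + 1)
  rw [lt_div_iff₀ hC, ← sub_pos, ← mul_pos_iff_of_pos_right hS, h, mul_pos_iff_of_pos_left hp,
    sub_pos, mul_comm]

lemma gain_succ_lt_gain_iff (hr : 0 < r) (hC : 0 < C) (m : ℕ) :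
    gain r v C (m + 1) < gain r v C m ↔ v / C < naorFunction r ((m + 1 : ℕ) : ℝ) := by
  have h := gain_succ_sub (v := v) (C := C) hr m
  have hS : 0 < geomSum r (m + 1) * geomSum r m :=
    mul_pos (by linarith [one_le_geomSum hr (m + 1)]) (by linarith [one_le_geomSum hr m])
  have hp := pow_pos hr (m + 1)
  rw [div_lt_iff₀ hC, ← sub_pos, ← mul_pos_iff_of_pos_right hS, ← neg_sub (gain r v C (m + 1)),
    neg_mul, h, ← mul_neg, mul_pos_iff_of_pos_left hp, neg_sub, sub_pos, mul_comm C]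

/-- `v - C * (m + 1) ≤ gain m` if and only if raising the threshold `m` by one is not profitable. -/
lemma sub_le_gain (hr : 0 < r) (hC : 0 < C) {m : ℕ}
    (h : v / C ≤ naorFunction r ((m + 1 : ℕ) : ℝ)) : v - C * (m + 1) ≤ gain r v C m := by
  have hS : 0 < geomSum r m := by linarith [one_le_geomSum hr m]
  have h1 := geomSum_mul_sub_weightedBenefit (r := r) (v := v) (C := C) m
  rw [gain, le_div_iff₀ hS]
  rw [div_le_iff₀ hC] at h
  linarith

/-! ### The equation for the threshold -/

lemma le_naorFunction_natCast (hr : 0 < r) (m : ℕ) : (m : ℝ) ≤ naorFunction r m := by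
  induction m with
  | zero => simp [naorFunction_zero]
  | succ m ih =>
    rw [naorFunction_natCast_succ]; push_cast; linarith [one_le_geomSum hr m]

lemma continuous_naorFunction (hr : 0 < r) : Continuous (naorFunction r) := by
  unfold naorFunction
  split_ifs with h
  · fun_prop
  · have : Continuous fun x : ℝ => r ^ x := Real.continuous_const_rpow hr.ne'
    fun_prop

/-- For `r ≠ 1` the derivative has numerator `1 - r + r * r ^ x * log r`. Replacing `r ^ x * log r`
by the smaller `log r` leaves `1 - r + r * log r`, which is positive by `log (1 / r) < 1 / r - 1`.
-/
lemma strictMonoOn_naorFunction (hr : 0 < r) :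
    StrictMonoOn (naorFunction r) (Set.Ici 0) := by
  by_cases h : r = 1
  · intro x hx y hy hxy
    have hx' : 0 ≤ x := hx
    simp only [naorFunction, if_pos h]
    nlinarith
  · refine strictMonoOn_of_deriv_pos (convex_Ici 0) (continuous_naorFunction hr).continuousOn ?_
    intro x hx
    rw [interior_Ici] at hx
    have hx' : 0 < x := hx
    have hd : HasDerivAt (naorFunction r)
        ((1 * (1 - r) - r * (0 - r ^ x * Real.log r)) / (1 - r) ^ 2) x := by
      have h1 : HasDerivAt (fun x : ℝ => r ^ x) (r ^ x * Real.log r) x :=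
        Real.hasStrictDerivAt_const_rpow hr x |>.hasDerivAt
      have h2 := ((hasDerivAt_id x).mul_const (1 - r)).sub
        (((hasDerivAt_const x (1 : ℝ)).sub h1).const_mul r)
      have h3 := h2.div_const ((1 - r) ^ 2)
      have h4 : naorFunction r = fun x => (x * (1 - r) - r * (1 - r ^ x)) / (1 - r) ^ 2 := by
        ext y; simp [naorFunction, h]
      rw [h4]; exact h3
    rw [hd.deriv]
    have hne : 1 - r ≠ 0 := sub_ne_zero.mpr (Ne.symm h)
    refine div_pos ?_ (by positivity)
    have hlog : r - 1 < r * Real.log r := by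
      have h1 := Real.log_lt_sub_one_of_pos (inv_pos.mpr hr) (by simpa using h)
      rw [Real.log_inv] at h1
      have h2 := mul_lt_mul_of_pos_left h1 hr
      rw [mul_sub, mul_inv_cancel₀ hr.ne'] at h2
      linarith
    have hpow : Real.log r ≤ r ^ x * Real.log r := by
      rcases lt_or_gt_of_ne h with h1 | h1
      · have h2 := Real.rpow_le_one hr.le h1.le hx'.le
        nlinarith [Real.log_neg hr h1]
      · have h2 := Real.one_le_rpow h1.le hx'.le
        nlinarith [Real.log_pos h1]
    have := mul_le_mul_of_nonneg_left hpow hr.le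
    linarith

lemma exists_naorFunction_eq (hr : 0 < r) {y : ℝ} (hy : 0 ≤ y) :
    ∃ x, 0 ≤ x ∧ y = naorFunction r x := by
  have h1 : y ≤ naorFunction r (⌈y⌉₊ : ℝ) :=
    (Nat.le_ceil y).trans (le_naorFunction_natCast hr _)
  have h2 := intermediate_value_Icc (Nat.cast_nonneg (α := ℝ) ⌈y⌉₊)
    (continuous_naorFunction hr).continuousOn
  obtain ⟨x, hx, hxy⟩ := h2 ⟨by rw [naorFunction_zero]; exact hy, h1⟩
  exact ⟨x, hx.1, hxy.symm⟩

/-! ### Monotonicity of the gain on either side of the root -/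

section Threshold

variable {x : ℝ}

lemma gain_lt_gain_succ (hr : 0 < r) (hC : 0 < C) (hx : 0 ≤ x) (hv : v / C = naorFunction r x)
    {m : ℕ} (hm : (m : ℝ) + 1 < x) : gain r v C m < gain r v C (m + 1) := by
  rw [gain_lt_gain_succ_iff hr hC, hv]
  exact strictMonoOn_naorFunction hr (Nat.cast_nonneg (α := ℝ) _) hx (by exact_mod_cast hm)

lemma gain_succ_lt_gain (hr : 0 < r) (hC : 0 < C) (hx : 0 ≤ x) (hv : v / C = naorFunction r x)
    {m : ℕ} (hm : x < (m : ℝ) + 1) : gain r v C (m + 1) < gain r v C m := by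
  rw [gain_succ_lt_gain_iff hr hC, hv]
  exact strictMonoOn_naorFunction hr hx (Nat.cast_nonneg (α := ℝ) _) (by exact_mod_cast hm)

lemma gain_le_gain_succ (hr : 0 < r) (hC : 0 < C) (hx : 0 ≤ x) (hv : v / C = naorFunction r x)
    {m : ℕ} (hm : (m : ℝ) + 1 ≤ x) : gain r v C m ≤ gain r v C (m + 1) := by
  rw [← not_lt, gain_succ_lt_gain_iff hr hC, hv, not_lt]
  exact (strictMonoOn_naorFunction hr).monotoneOn (Nat.cast_nonneg (α := ℝ) _) hx
    (by exact_mod_cast hm)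

lemma gain_le_gain_floor (hr : 0 < r) (hC : 0 < C) (hx : 0 ≤ x) (hv : v / C = naorFunction r x)
    {m : ℕ} (hm : m ≤ ⌊x⌋₊) : gain r v C m ≤ gain r v C ⌊x⌋₊ := by
  refine Nat.decreasingInduction' (P := fun k => gain r v C k ≤ gain r v C ⌊x⌋₊)
    (fun k hk _ ih => ?_) hm le_rfl
  refine (gain_le_gain_succ hr hC hx hv ?_).trans ih
  exact_mod_cast (Nat.le_floor_iff hx).mp hk

/-- Only the two thresholds of the theorem can attain the maximal gain. -/
lemma eq_floor_or_of_gain_ge (hr : 0 < r) (hC : 0 < C) (hx : 0 ≤ x)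
    (hv : v / C = naorFunction r x) {m : ℕ} (hm : gain r v C ⌊x⌋₊ ≤ gain r v C m) :
    m = ⌊x⌋₊ ∨ (m : ℝ) + 1 = x := by
  rcases lt_trichotomy m ⌊x⌋₊ with h | h | h
  · right
    have h1 : (m : ℝ) + 1 ≤ x := by exact_mod_cast (Nat.le_floor_iff hx).mp h
    -- Below the floor, the step from `m` to `m + 1` is a strict gain unless `m + 1` is the root
    -- itself.
    by_contra hne
    have h2 := gain_lt_gain_succ hr hC hx hv (lt_of_le_of_ne h1 hne)
    have h3 := gain_le_gain_floor hr hC hx hv (Nat.succ_le_of_lt h)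
    exact absurd hm (not_le.mpr (h2.trans_le h3))
  · exact Or.inl h
  · exfalso
    have h1 : ∀ k, ⌊x⌋₊ < k → gain r v C k < gain r v C ⌊x⌋₊ := by
      intro k hk
      induction k, hk using Nat.le_induction with
      | base => exact gain_succ_lt_gain hr hC hx hv (Nat.lt_floor_add_one x)
      | succ k hk ih =>
        refine (gain_succ_lt_gain hr hC hx hv ?_).trans ih
        refine (Nat.lt_floor_add_one x).trans_le ?_
        have : ⌊x⌋₊ ≤ k := by omega
        exact_mod_cast Nat.succ_le_succ this
    exact absurd hm (not_le.mpr (h1 m h))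

end Threshold

end Gain

/-! ### Relative values -/

section RelativeValue

variable {lamA lamB mu RA CA : ℝ}

/-- The relative value of having `i + 1` instead of `i` customers when the gain is `g`, computed
upwards from the empty system. -/
noncomputable def marginalValue (lamA mu RA CA g : ℝ) (i : ℕ) : ℝ :=
  (g * geomSum (lamA / mu) i - weightedBenefit (lamA / mu) (RA * mu) CA i)
    / (mu * (lamA / mu) ^ (i + 1))

lemma lamA_mul_marginalValue_zero (hA : 0 < lamA) (hmu : 0 < mu) (g : ℝ) :
    lamA * marginalValue lamA mu RA CA g 0 = g := by
  simp only [marginalValue, geomSum, weightedBenefit]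
  simp
  field_simp

/-- The average-reward equation in state `n + 1` when arrivals are admitted; the preceding lemma is
its version for the empty system. -/
lemma lamA_mul_marginalValue_succ (hA : 0 < lamA) (hmu : 0 < mu) (g : ℝ) (n : ℕ) :
    lamA * marginalValue lamA mu RA CA g (n + 1) - mu * marginalValue lamA mu RA CA g n
      = g - (RA * mu - CA * (n + 1)) := by
  have hr : 0 < lamA / mu := div_pos hA hmu
  simp only [marginalValue, geomSum_succ, weightedBenefit]
  set r := lamA / mu with hrdef
  have hl : lamA = r * mu := by rw [hrdef]; field_simp
  rw [hl]
  have : r ^ (n + 1) ≠ 0 := (pow_pos hr _).ne'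
  rw [pow_succ r (n + 1)]
  field_simp
  ring

/-- At the threshold arrivals are refused, so the recursion must close with value zero; this
boundary condition determines the gain. -/
lemma marginalValue_gain_self (hA : 0 < lamA) (hmu : 0 < mu) (m : ℕ) :
    marginalValue lamA mu RA CA (gain (lamA / mu) (RA * mu) CA m) m = 0 := by
  rw [marginalValue, gain_mul_geomSum (div_pos hA hmu), sub_self, zero_div]

lemma marginalValue_nonneg (hA : 0 < lamA) (hmu : 0 < mu) {g : ℝ} {i : ℕ}
    (h : gain (lamA / mu) (RA * mu) CA i ≤ g) : 0 ≤ marginalValue lamA mu RA CA g i := by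
  have hr : 0 < lamA / mu := div_pos hA hmu
  refine div_nonneg ?_ (by positivity)
  rw [← gain_mul_geomSum hr, ← sub_mul]
  exact mul_nonneg (sub_nonneg.mpr h) (by linarith [one_le_geomSum hr i])

/-- Against every strategy, the gain of the threshold strategy with threshold `⌊x⌋` is not
exceeded. -/
lemma exists_integral_le_gain_floor (hA : 0 < lamA) (hB : 0 ≤ lamB) (hmu : 0 < mu)
    (hC : 0 < CA) {x : ℝ} (hx : 0 ≤ x) (hv : RA * mu / CA = naorFunction (lamA / mu) x)
    (σ τ : Strategy) (s₀ : ℕ × ℕ) :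
    ∃ c, ∀ T, 0 ≤ T → ∫ w, netBenefitA RA CA σ τ s₀ T w ∂(pathLaw lamA lamB mu)
      ≤ gain (lamA / mu) (RA * mu) CA ⌊x⌋₊ * T + c := by
  have hr : 0 < lamA / mu := div_pos hA hmu
  set m := ⌊x⌋₊ with hm
  set g := gain (lamA / mu) (RA * mu) CA m with hg
  -- An arbitrary strategy may let the queue grow without bound; zero increments from `m` on keep
  -- `h` bounded.
  set d : ℕ → ℝ := fun i => if i < m then marginalValue lamA mu RA CA g i else 0 with hd
  set h : ℕ → ℝ := fun n => ∑ i ∈ Finset.range n, d i with hh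
  have hsucc : ∀ n, h (n + 1) = h n + d n := fun n => Finset.sum_range_succ _ _
  have hd0 : ∀ i, 0 ≤ d i := by
    intro i
    simp only [hd]
    split_ifs with hi
    · exact marginalValue_nonneg hA hmu (gain_le_gain_floor hr hC hx hv hi.le)
    · exact le_rfl
  have hmono : Monotone h := monotone_nat_of_le_succ fun n => by
    rw [hsucc]; linarith [hd0 n]
  have hnn : ∀ n, 0 ≤ h n := fun n => Finset.sum_nonneg fun i _ => hd0 i
  have hle : ∀ n, h n ≤ h m := by
    intro n
    rcases le_total n m with hn | hn
    · exact hmono hn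
    · induction n, hn using Nat.le_induction with
      | base => exact le_rfl
      | succ n hn ih =>
        rw [hsucc, hd]
        simp only [if_neg (not_lt.mpr hn)]
        linarith
  -- The cut at `m` is seamless, so the equation still holds with equality in state `m`.
  have hdtop : ∀ i, i ≤ m → d i = marginalValue lamA mu RA CA g i := by
    intro i hi
    rcases hi.lt_or_eq with hi | rfl
    · simp [hd, hi]
    · simp [hd, hg, marginalValue_gain_self hA hmu]
  have hkey : ∀ n, rateSum lamA lamB mu
      (fun e => serviceReward RA e n + h (afterEvent e (n, 0)).1 - h n) - CA * (n : ℝ) ≤ g := by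
    intro n
    rcases n with _ | n
    · simp only [rateSum, serviceReward, afterEvent, hsucc]
      have h1 := lamA_mul_marginalValue_zero (RA := RA) (CA := CA) hA hmu g
      rw [← hdtop 0 (Nat.zero_le _)] at h1
      simp
      linarith
    · simp only [rateSum, serviceReward, afterEvent, hsucc]
      simp only [reduceCtorEq, false_and, if_false, true_and, Nat.succ_pos, if_true,
        Nat.add_sub_cancel]
      rcases lt_or_ge n m with hn | hn
      · have h1 := lamA_mul_marginalValue_succ (RA := RA) (CA := CA) hA hmu g n
        rw [← hdtop (n + 1) hn, ← hdtop n hn.le] at h1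
        push_cast
        linarith
      · have h1 : d n = 0 := by simp [hd, not_lt.mpr hn]
        have h2 : d (n + 1) = 0 := by simp [hd, not_lt.mpr (hn.trans (Nat.le_succ n))]
        -- Above `m` the function `h` is flat, and it suffices that the net reward rate in state `m
        -- + 1` does not exceed `g`; this holds because `x ≤ m + 1`.
        have h3 : RA * mu - CA * (m + 1) ≤ g := by
          refine sub_le_gain hr hC ?_
          rw [hv]
          exact (strictMonoOn_naorFunction hr).monotoneOn hx (Nat.cast_nonneg (α := ℝ) _)
            (by push_cast; exact (Nat.lt_floor_add_one x).le)
        have h4 : CA * (m : ℝ) ≤ CA * n :=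
          mul_le_mul_of_nonneg_left (by exact_mod_cast hn) hC.le
        rw [h1, h2]
        push_cast
        linarith
  refine ⟨2 * h m, fun T hT => ?_⟩
  -- The planner can only lower the number left by the event, hence monotonicity of `h` covers every
  -- decision. The second coordinate `0` is a dummy.
  refine integral_netBenefitA_le hA hB hmu hT h (fun e n => h (afterEvent e (n, 0)).1) g (h m)
    (fun w k => ?_) (fun w k => hmono ?_) (fun w k => hkey _)
  · rw [abs_of_nonneg (hnn _)]; exact hle _
  · rw [state_succ]
    refine (min_le_left _ _).trans (le_of_eq ?_)
    generalize (w k).1 = e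
    cases e <;> simp only [afterEvent]
    split_ifs <;> rfl

/-- The number of `A`-customers after the given event under the threshold strategy. -/
def thresholdNext (m : ℕ) : Event → ℕ → ℕ
  | Event.arrivalA, n => if n < m then n + 1 else n
  | Event.arrivalB, n => n
  | Event.service, n => n - 1

lemma state_thresholdStrategyA_succ (m : ℕ) (τ : Strategy) (s₀ : ℕ × ℕ) (w : Path) (k : ℕ) :
    (state (thresholdStrategyA m) τ s₀ w (k + 1)).1
      = thresholdNext m (w k).1 (state (thresholdStrategyA m) τ s₀ w k).1 := by
  rw [state_succ]
  simp only [thresholdStrategyA, Fin.val_last]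
  generalize (w k).1 = e
  generalize state _ τ s₀ w k = s
  cases e <;> simp only [afterEvent, thresholdKeep, thresholdNext]
  · simp only [Nat.add_sub_cancel]
    split_ifs <;> simp
  · simp
  · split_ifs with h
    · simp
    · simp only [min_self]; omega

lemma state_thresholdStrategyA_le (m : ℕ) (τ : Strategy) (s₀ : ℕ × ℕ) (w : Path) (k : ℕ) :
    (state (thresholdStrategyA m) τ s₀ w k).1 ≤ max m s₀.1 := by
  induction k with
  | zero => exact le_max_right _ _
  | succ k ih =>
    rw [state_thresholdStrategyA_succ]
    generalize (w k).1 = e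
    generalize (state _ τ s₀ w k).1 = n at ih ⊢
    cases e <;> simp only [thresholdNext]
    · split_ifs with h
      · exact (Nat.succ_le_of_lt h).trans (le_max_left _ _)
      · exact ih
    · exact ih
    · omega

/-- The expected net benefit of a threshold strategy grows at the rate of its gain. -/
lemma exists_abs_integral_sub_gain_le (hA : 0 < lamA) (hB : 0 ≤ lamB) (hmu : 0 < mu) (m : ℕ)
    (τ : Strategy) (s₀ : ℕ × ℕ) :
    ∃ c, ∀ T, 0 ≤ T →
      |∫ w, netBenefitA RA CA (thresholdStrategyA m) τ s₀ T w ∂(pathLaw lamA lamB mu)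
        - gain (lamA / mu) (RA * mu) CA m * T| ≤ c := by
  set g := gain (lamA / mu) (RA * mu) CA m with hg
  -- From `m` on the increments solve the equation without arrivals, for initial states above the
  -- threshold. The resulting `h` may be unbounded, but only states up to `max m s₀.1` are visited.
  set d : ℕ → ℝ := fun i => if i < m then marginalValue lamA mu RA CA g i
    else (RA * mu - CA * (i + 1) - g) / mu with hd
  set h : ℕ → ℝ := fun n => ∑ i ∈ Finset.range n, d i with hh
  have hsucc : ∀ n, h (n + 1) = h n + d n := fun n => Finset.sum_range_succ _ _
  have htop := marginalValue_gain_self (RA := RA) (CA := CA) hA hmu m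
  have hkey : ∀ n, rateSum lamA lamB mu
      (fun e => serviceReward RA e n + h (thresholdNext m e n) - h n) - CA * (n : ℝ) = g := by
    intro n
    rcases n with _ | n
    · have h1 := lamA_mul_marginalValue_zero (RA := RA) (CA := CA) hA hmu g
      simp only [rateSum, serviceReward, thresholdNext]
      rcases Nat.eq_zero_or_pos m with h0 | h0
      · subst h0
        rw [htop] at h1
        simp
        linarith
      · rw [if_pos h0, hsucc 0, show d 0 = marginalValue lamA mu RA CA g 0 by simp [hd, h0]]
        simp
        linarith
    · simp only [rateSum, serviceReward, thresholdNext]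
      simp only [reduceCtorEq, false_and, if_false, true_and, Nat.succ_pos, if_true,
        Nat.add_sub_cancel]
      have h1 := lamA_mul_marginalValue_succ (RA := RA) (CA := CA) hA hmu g n
      rcases lt_trichotomy (n + 1) m with hn | hn | hn
      · rw [if_pos hn, hsucc (n + 1), hsucc n]
        have h2 : d (n + 1) = marginalValue lamA mu RA CA g (n + 1) := by simp [hd, hn]
        have h3 : d n = marginalValue lamA mu RA CA g n := by
          simp [hd, (Nat.lt_succ_self n).trans hn]
        rw [h2, h3]
        push_cast
        linarith
      · rw [if_neg (by omega), hsucc n]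
        have h3 : d n = marginalValue lamA mu RA CA g n := by
          simp [hd, show n < m by omega]
        rw [hn, htop] at h1
        rw [h3]
        push_cast
        linarith
      · rw [if_neg (by omega), hsucc n]
        have h3 : mu * d n = RA * mu - CA * (n + 1) - g := by
          simp only [hd, if_neg (show ¬ n < m by omega)]
          field_simp
        push_cast
        linarith
  set M := ∑ n ∈ Finset.range (max m s₀.1 + 1), |h n| with hM
  refine ⟨2 * M, fun T hT => ?_⟩
  refine abs_integral_netBenefitA_sub_le hA hB hmu hT h (fun e n => h (thresholdNext m e n)) g M
    (fun w k => ?_) (fun w k => ?_) (fun w k => hkey _)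
  · exact Finset.single_le_sum (f := fun n => |h n|) (fun _ _ => abs_nonneg _)
      (Finset.mem_range.mpr (Nat.lt_succ_of_le (state_thresholdStrategyA_le m τ s₀ w k)))
  · rw [state_thresholdStrategyA_succ]

end RelativeValue

/-! ### Long-run averages -/

lemma tendsto_mul_add_div (g c : ℝ) :
    Tendsto (fun T : ℝ => (g * T + c) / T) atTop (nhds g) := by
  have h1 : Tendsto (fun T : ℝ => g + c * T⁻¹) atTop (nhds (g + c * 0)) :=
    (tendsto_inv_atTop_zero.const_mul c).const_add g
  rw [mul_zero, add_zero] at h1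
  refine h1.congr' ?_
  filter_upwards [eventually_gt_atTop 0] with T hT
  field_simp

lemma limsup_div_le {f : ℝ → ℝ} {g c : ℝ} (h : ∀ T, 0 ≤ T → f T ≤ g * T + c) :
    limsup (fun T : ℝ => ((f T / T : ℝ) : EReal)) atTop ≤ (g : EReal) := by
  rw [← (EReal.tendsto_coe.mpr (tendsto_mul_add_div g c)).limsup_eq]
  refine limsup_le_limsup ?_
  filter_upwards [eventually_gt_atTop 0] with T hT
  exact EReal.coe_le_coe_iff.mpr (div_le_div_of_nonneg_right (h T hT.le) hT.le)

lemma le_liminf_div {f : ℝ → ℝ} {g c : ℝ} (h : ∀ T, 0 ≤ T → g * T + c ≤ f T) :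
    (g : EReal) ≤ liminf (fun T : ℝ => ((f T / T : ℝ) : EReal)) atTop := by
  rw [← (EReal.tendsto_coe.mpr (tendsto_mul_add_div g c)).liminf_eq]
  refine liminf_le_liminf ?_
  filter_upwards [eventually_gt_atTop 0] with T hT
  exact EReal.coe_le_coe_iff.mpr (div_le_div_of_nonneg_right (h T hT.le) hT.le)

lemma tendsto_averageBenefitA_threshold {lamA lamB mu : ℝ} (RA CA : ℝ) (hA : 0 < lamA)
    (hB : 0 ≤ lamB) (hmu : 0 < mu) (m : ℕ) (τ : Strategy) (s₀ : ℕ × ℕ) :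
    Tendsto (fun T : ℝ =>
      ((averageBenefitA lamA lamB mu RA CA (thresholdStrategyA m) τ s₀ T : ℝ) : EReal)) atTop
      (nhds ((gain (lamA / mu) (RA * mu) CA m : ℝ) : EReal)) := by
  obtain ⟨c, hc⟩ := exists_abs_integral_sub_gain_le (RA := RA) (CA := CA) hA hB hmu m τ s₀
  refine tendsto_of_le_liminf_of_limsup_le ?_ ?_
  · exact le_liminf_div (c := -c) fun T hT => by
      linarith [(abs_le.mp (hc T hT)).1]
  · exact limsup_div_le (c := c) fun T hT => by
      linarith [(abs_le.mp (hc T hT)).2]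

end PriorityQueue

/-! ### Optimality of the threshold and its uniqueness up to ties -/

theorem mainTheorem6 (lamA lamB mu RA CA : ℝ) (hlamA : 0 < lamA) (hlamB : 0 ≤ lamB)
    (hmu : 0 < mu) (hCA : 0 < CA) (hRA : CA ≤ RA * mu) :
    (∀ (σ τ : PriorityQueue.Strategy) (s₀ : ℕ × ℕ) (T : ℝ), 0 ≤ T →
      Integrable (PriorityQueue.netBenefitA RA CA σ τ s₀ T)
        (PriorityQueue.pathLaw lamA lamB mu)) ∧
    ∃ nA : ℝ,
      (0 ≤ nA ∧ RA * mu / CA = PriorityQueue.naorFunction (lamA / mu) nA) ∧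
      (∀ x : ℝ, 0 ≤ x → RA * mu / CA = PriorityQueue.naorFunction (lamA / mu) x → x = nA) ∧
      PriorityQueue.IsOptimalA lamA lamB mu RA CA (PriorityQueue.thresholdStrategyA ⌊nA⌋₊) ∧
      (∀ m : ℕ,
        PriorityQueue.IsOptimalA lamA lamB mu RA CA (PriorityQueue.thresholdStrategyA m) →
          m = ⌊nA⌋₊ ∨ (m : ℝ) + 1 = nA) := by
  have hr : 0 < lamA / mu := div_pos hlamA hmu
  refine ⟨fun σ τ s₀ T hT =>
    (PriorityQueue.integrable_netBenefitA_and_hasSum hlamA hlamB hmu hT).1, ?_⟩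
  obtain ⟨x, hx, hv⟩ := PriorityQueue.exists_naorFunction_eq hr
    (div_nonneg (hCA.le.trans hRA) hCA.le)
  refine ⟨x, ⟨hx, hv⟩, fun y hy hvy =>
    (PriorityQueue.strictMonoOn_naorFunction hr).injOn hy hx (hvy.symm.trans hv), ?_, ?_⟩
  · intro τ s₀ σ'
    rw [(PriorityQueue.tendsto_averageBenefitA_threshold RA CA hlamA hlamB hmu _ τ s₀).liminf_eq]
    obtain ⟨c, hc⟩ := PriorityQueue.exists_integral_le_gain_floor hlamA hlamB hmu hCA hx hv
      σ' τ s₀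
    exact PriorityQueue.limsup_div_le hc
  · intro m hm
    refine PriorityQueue.eq_floor_or_of_gain_ge hr hCA hx hv ?_
    -- Gains depend neither on the opponent nor on the initial state, so any choice serves; here a
    -- threshold strategy merely fills the role of `τ`.
    have h := hm (PriorityQueue.thresholdStrategyA m) (0, 0)
      (PriorityQueue.thresholdStrategyA ⌊x⌋₊)
    rw [(PriorityQueue.tendsto_averageBenefitA_threshold RA CA hlamA hlamB hmu _ _ _).limsup_eq,
      (PriorityQueue.tendsto_averageBenefitA_threshold RA CA hlamA hlamB hmu _ _ _).liminf_eq]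
      at h
    exact EReal.coe_le_coe_iff.mp h
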